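/- Write $|\cdot|$ for area, $o$ for the origin of $\mathbb{R}^2$, and $K^*=\{x\in\mathbb{R}^2:\ \langle x,y\rangle\le 1\ \text{for all } y\in K\}$ for the polar of a set $K$ with respect to $o$. For planar convex bodies $K,L$ let the Banach--Mazur distance $\delta_{BM}(K,L)$ be the minimum of $\lambda_2/\lambda_1$ over all $\lambda_1,\lambda_2>0$ for which there are an (invertible) affine map $A$ and a point $x\in\mathbb{R}^2$ with $\lambda_1A(K)\subset L\subset \lambda_2A(K)+x$. Let $K\subset\mathbb{R}^2$ be a convex body that is centrally symmetric about some point (not necessarily $o$), let $o\in\operatorname{int}K$, let $\varepsilon>0$, and suppose that $|K|\cdot|K^*|\le 8(1+\varepsilon)$. Then $\delta_{BM}(K,P)\le 1+200\,\varepsilon$ for every parallelogram $P$. Moreover, let $x\in\mathbb{R}^2$, let $\lambda_1,\lambda_2>0$, and let $P$ be a parallelogram such that $\lambda_1P+x\subset K\subset\lambda_2P+x$ and $\lambda_2/\lambda_1\le 1+200\,\varepsilon<2$. Then, measured in the Euclidean norm (the norm of an inner product on $\mathbb{R}^2$) for which $\frac{\lambda_1+\lambda_2}{2}P$ is a square of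 diameter $1$, the distance from $o$ of the centre of $\frac{\lambda_1+\lambda_2}{2}P+x$ is at most $336\sqrt{\varepsilon}$. -/

import Mathlib

open Set MeasureTheory
open scoped Pointwise

namespace PlanarBody

/-- The Euclidean plane. -/
abbrev Plane : Type := EuclideanSpace ℝ (Fin 2)

/-- The polar `K* = {x : ⟨x, y⟩ ≤ 1 for all y ∈ K}` (one-sided, with respect to the unit circle
about the origin). -/
def polarSet (K : Set Plane) : Set Plane := {x | ∀ y ∈ K, inner ℝ x y ≤ 1}

/-- `c` is a centre of symmetry of `S`. -/
def IsCentre (c : Plane) (S : Set Plane) : Prop := Equiv.pointReflection c '' S = S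

/-- `S` is a (nondegenerate) parallelogram: a translate of the parallelepiped spanned by two
linearly independent vectors. -/
def IsParallelogram (S : Set Plane) : Prop :=
  ∃ (p : Plane) (v : Fin 2 → Plane), LinearIndependent ℝ v ∧ S = p +ᵥ parallelepiped v

/-- The ratios `l₂ / l₁` with `l₁ A(K) ⊆ L ⊆ l₂ A(K) + x` for some affinity `A` and point `x`. -/
def banachMazurRatios (K L : Set Plane) : Set ℝ :=
  {r | ∃ (l₁ l₂ : ℝ) (A : Plane ≃ᵃ[ℝ] Plane) (x : Plane), 0 < l₁ ∧ 0 < l₂ ∧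
    l₁ • (A '' K) ⊆ L ∧ L ⊆ x +ᵥ l₂ • (A '' K) ∧ r = l₂ / l₁}

/-- The Banach–Mazur distance of two convex bodies (not necessarily symmetric). -/
noncomputable def banachMazurDist (K L : Set Plane) : ℝ := sInf (banachMazurRatios K L)

theorem bddBelow_banachMazurRatios (K L : Set Plane) : BddBelow (banachMazurRatios K L) := by
  refine ⟨0, ?_⟩
  rintro r ⟨l₁, l₂, A, x, h₁, h₂, -, -, rfl⟩
  positivity

/-- The infimum is over a nonempty set as soon as both bodies are bounded with an interior point. -/
theorem banachMazurRatios_nonempty {K L : Set Plane} (hK : Bornology.IsBounded K)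
    (hL : Bornology.IsBounded L) (hK' : (interior K).Nonempty) (hL' : (interior L).Nonempty) :
    (banachMazurRatios K L).Nonempty := by
  obtain ⟨k, hk⟩ := hK'
  obtain ⟨l, hl⟩ := hL'
  obtain ⟨r, hr, hrK⟩ := Metric.mem_nhds_iff.1 (mem_interior_iff_mem_nhds.1 hk)
  obtain ⟨s, hs, hsL⟩ := Metric.mem_nhds_iff.1 (mem_interior_iff_mem_nhds.1 hl)
  obtain ⟨R, hR, hRK⟩ := hK.subset_ball_lt 0 k
  obtain ⟨S, hS, hSL⟩ := hL.subset_ball_lt 0 l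
  have h₁ : 0 < s / R := by positivity
  have h₂ : 0 < S / r := by positivity
  refine ⟨_, s / R, S / r, AffineEquiv.constVAdd ℝ Plane ((s / R)⁻¹ • l - k),
    l - (S / r) • ((s / R)⁻¹ • l), h₁, h₂, ?_, ?_, rfl⟩
  · rintro _ ⟨_, ⟨y, hy, rfl⟩, rfl⟩
    apply hsL
    have hy' := hRK hy
    rw [Metric.mem_ball, dist_eq_norm] at hy' ⊢
    have : (s / R) • ((s / R)⁻¹ • l - k + y) - l = (s / R) • (y - k) := by
      rw [smul_add, smul_sub, smul_inv_smul₀ h₁.ne', smul_sub]; abel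
    simp only [AffineEquiv.constVAdd_apply, vadd_eq_add]
    rw [this, norm_smul, Real.norm_of_nonneg h₁.le]
    calc s / R * ‖y - k‖ < s / R * R := by gcongr
      _ = s := by field_simp
  · intro y hy
    have hy' := hSL hy
    rw [Metric.mem_ball, dist_eq_norm] at hy'
    refine ⟨(S / r) • ((s / R)⁻¹ • l - k + (k + (S / r)⁻¹ • (y - l))),
      ⟨_, ⟨k + (S / r)⁻¹ • (y - l), hrK ?_, rfl⟩, rfl⟩, ?_⟩
    · rw [Metric.mem_ball, dist_eq_norm, add_sub_cancel_left, norm_smul,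
        Real.norm_of_nonneg (inv_nonneg.2 h₂.le)]
      calc (S / r)⁻¹ * ‖y - l‖ < (S / r)⁻¹ * S := by gcongr
        _ = r := by field_simp
    · simp only [vadd_eq_add]
      rw [← add_assoc, sub_add_cancel, smul_add, smul_inv_smul₀ h₂.ne']; abel

/-- `B` is an inner product on the plane. -/
def IsInnerProduct (B : LinearMap.BilinForm ℝ Plane) : Prop :=
  (∀ v w, B v w = B w v) ∧ ∀ v, v ≠ 0 → 0 < B v v

/-- The Euclidean norm given by an inner product `B`. -/
noncomputable def normOf (B : LinearMap.BilinForm ℝ Plane) (v : Plane) : ℝ := √(B v v)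

/-- `S` is a square in the Euclidean geometry given by `B`: a parallelogram with adjacent edges
that are orthogonal and of equal length. -/
def IsSquareFor (B : LinearMap.BilinForm ℝ Plane) (S : Set Plane) : Prop :=
  ∃ (p : Plane) (v : Fin 2 → Plane), LinearIndependent ℝ v ∧
    B (v 0) (v 1) = 0 ∧ normOf B (v 0) = normOf B (v 1) ∧ S = p +ᵥ parallelepiped v

/-- `S` has diameter `d` in the Euclidean norm given by `B`. -/
def HasDiameterFor (B : LinearMap.BilinForm ℝ Plane) (S : Set Plane) (d : ℝ) : Prop :=
  IsLUB {t | ∃ y ∈ S, ∃ z ∈ S, t = normOf B (y - z)} d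

end PlanarBody

/-! Translate $K$ to its centre, getting $C=K-k$, and take $u,v\in C$ spanning a parallelogram of
maximal area. In the coordinates of $u,v$ the body $C$ lies between the $\ell^1$ ball and the
$\ell^\infty$ ball, and so does its polar $L$ in the dual basis. It suffices to show that one of the
two is close to the $\ell^1$ ball: this makes $C$ close either to the $\ell^1$ ball or, by duality,
to the $\ell^\infty$ ball, and both are parallelograms.

In one quadrant let $1+t$ be the maximum of $z_1+z_2$ over $C$. Triangles spanned by explicit points
of $C$, and by explicit normals lying in $L$, bound the normalized areas $X,Y$ of the two sectors
from below, with $XY\ge 2+t(1-t)/5$ (`quadrant_bound`). An almost minimal product therefore forces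
$t$ to be at most $200\varepsilon$ or at least $0.8$ in every quadrant, for $C$ and for $L$. A large
value for each of them contradicts the product bound (`close_to_ball_of_sector_mul_le`).

The polar $D=K^*$ is taken at $o$ and not at the centre. Opposite sectors are always counted
together, and then $D$ satisfies the same triangle bounds as $L$ (`exists_scaled_mem_polarSet`,
`one_le_half_add_inv_mul_inv`). The quadrant argument uses only these bounds and superadditivity
over adjacent sectors, both recorded in `IsSectorArea`, so no comparison of polars at different
points is needed.

For the centre, $K$ contains the small parallelogram, while $K^*$ contains the polar of the large
one at $o$, whose area grows quadratically as $o$ leaves its centre (`sq_mul_inv_add_inv_le`). This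
bounds the offset by a multiple of $\sqrt\varepsilon$. -/

namespace PlanarBody

/-! ### Cross products and areas in sectors. -/

/-- The oriented area of the parallelogram spanned by `u` and `v`. -/
def cross (u v : Plane) : ℝ := u 0 * v 1 - u 1 * v 0

/-- The convex cone spanned by `u` and `v`. -/
def sector (u v : Plane) : Set Plane := {z | ∃ a b : ℝ, 0 ≤ a ∧ 0 ≤ b ∧ z = a • u + b • v}

theorem cross_smul_add_right (u v w : Plane) (a b : ℝ) :
    cross u (a • v + b • w) = a * cross u v + b * cross u w := by
  simp [cross]; ring

theorem cross_smul_add_left (u v w : Plane) (a b : ℝ) :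
    cross (a • v + b • w) u = a * cross v u + b * cross w u := by
  simp [cross]; ring

@[simp] theorem cross_self (u : Plane) : cross u u = 0 := by simp [cross]; ring

theorem cross_swap (u v : Plane) : cross v u = -cross u v := by simp [cross]; ring

@[simp] theorem cross_neg_right (u v : Plane) : cross u (-v) = -cross u v := by simp [cross]; ring

@[simp] theorem cross_neg_left (u v : Plane) : cross (-u) v = -cross u v := by simp [cross]; ring

theorem cross_smul_smul (u v : Plane) (a b : ℝ) : cross (a • u) (b • v) = a * b * cross u v := by
  simp [cross]; ring

theorem cross_smul_eq (u v z : Plane) :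
    cross u v • z = cross z v • u + cross u z • v := by
  ext i
  fin_cases i <;> simp [cross] <;> ring

theorem exists_eq_smul_add_smul {u v : Plane} (h : cross u v ≠ 0) (z : Plane) :
    z = (cross z v / cross u v) • u + (cross u z / cross u v) • v := by
  have := congrArg ((cross u v)⁻¹ • ·) (cross_smul_eq u v z)
  simp only [inv_smul_smul₀ h, smul_add, smul_smul] at this
  rw [this]
  simp only [div_eq_inv_mul, ← this]

theorem inner_eq (u v : Plane) : inner ℝ u v = u 0 * v 0 + u 1 * v 1 := by
  simp [PiLp.inner_apply, Fin.sum_univ_two]; ring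

theorem continuous_cross_right (u : Plane) : Continuous fun z => cross u z := by
  unfold cross; fun_prop

theorem volume_parallelepiped_pair (u v : Plane) :
    volume (parallelepiped ![u, v]) = ENNReal.ofReal |cross u v| := by
  have h := (EuclideanSpace.basisFun (Fin 2) ℝ).addHaar_eq_volume
  rw [← h, Measure.addHaar_parallelepiped]
  congr 2
  rw [Module.Basis.det_apply, Matrix.det_fin_two]
  simp [Module.Basis.toMatrix_apply, cross]
  ring

theorem sector_smul {a b : ℝ} (ha : 0 < a) (hb : 0 < b) (u v : Plane) :
    sector (a • u) (b • v) = sector u v := by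
  ext z
  constructor
  · rintro ⟨s, t, hs, ht, rfl⟩
    exact ⟨s * a, t * b, by positivity, by positivity, by module⟩
  · rintro ⟨s, t, hs, ht, rfl⟩
    refine ⟨s / a, t / b, by positivity, by positivity, ?_⟩
    rw [smul_smul, smul_smul, div_mul_cancel₀ _ ha.ne', div_mul_cancel₀ _ hb.ne']

/-- The parallelogram on $u,v$ is the triangle $0,u,v$ together with its reflection in $(u+v)/2$,
and convexity puts the triangle inside $S$. -/
theorem cross_le_two_mul_volume_sector {S : Set Plane} (hS : Convex ℝ S) (h0 : (0 : Plane) ∈ S)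
    {u v : Plane} (hu : u ∈ S) (hv : v ∈ S) :
    ENNReal.ofReal |cross u v| ≤ 2 * volume (S ∩ sector u v) := by
  rw [← volume_parallelepiped_pair]
  set T := S ∩ sector u v
  have tri : ∀ a b : ℝ, 0 ≤ a → 0 ≤ b → a + b ≤ 1 → a • u + b • v ∈ T := by
    intro a b ha hb hab
    refine ⟨?_, a, b, ha, hb, rfl⟩
    have := hS.sum_mem (t := Finset.univ) (w := ![1 - a - b, a, b]) (z := ![0, u, v])
      (by intro i _; fin_cases i <;> simp <;> linarith) (by simp [Fin.sum_univ_three]; ring)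
      (by intro i _; fin_cases i <;> simp [*])
    simpa [Fin.sum_univ_three] using this
  have hsub : parallelepiped ![u, v] ⊆ T ∪ (fun z => (u + v) - z) ⁻¹' T := by
    intro z hz
    rw [mem_parallelepiped_iff] at hz
    obtain ⟨t, ⟨h0, h1⟩, rfl⟩ := hz
    have p0 := h0 0; have p1 := h0 1; have q0 := h1 0; have q1 := h1 1
    simp only [Pi.zero_apply, Pi.one_apply] at p0 p1 q0 q1
    simp only [Fin.sum_univ_two, Matrix.cons_val_zero, Matrix.cons_val_one]
    rcases le_total (t 0 + t 1) 1 with h | h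
    · exact Or.inl (tri _ _ p0 p1 h)
    · right
      have := tri (1 - t 0) (1 - t 1) (by linarith) (by linarith) (by linarith)
      rw [mem_preimage]
      convert this using 1
      module
  calc volume (parallelepiped ![u, v]) ≤ volume (T ∪ (fun z => (u + v) - z) ⁻¹' T) :=
        measure_mono hsub
    _ ≤ volume T + volume ((fun z => (u + v) - z) ⁻¹' T) := measure_union_le _ _
    _ = 2 * volume T := by
      have : volume ((fun z => (u + v) - z) ⁻¹' T) = volume T :=
        (Measure.measurePreserving_sub_left volume (u + v)).measure_preimage_equiv
          (f := MeasurableEquiv.subLeft (u + v)) T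
      rw [this, two_mul]

theorem volume_line_eq_zero {v : Plane} (hv : v ≠ 0) : volume {z | cross v z = 0} = 0 := by
  let f : Plane →ₗ[ℝ] ℝ :=
    { toFun := cross v
      map_add' := fun x y => by simp [cross]; ring
      map_smul' := fun a x => by simp [cross]; ring }
  have : {z | cross v z = 0} = (LinearMap.ker f : Set Plane) := by
    ext z; simp [f]
  rw [this]
  refine Measure.addHaar_submodule _ _ fun h => hv ?_
  have h0 : ∀ z, cross v z = 0 := fun z => by
    have : z ∈ LinearMap.ker f := h ▸ Submodule.mem_top
    simpa [f] using this
  have a := h0 (!₂[1, 0])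
  have b := h0 (!₂[0, 1])
  simp [cross] at a b
  ext i
  fin_cases i <;> simp [a, b]

theorem volume_add_le_of_separated {S A B : Set Plane} {v : Plane} (hv : v ≠ 0) (hA : A ⊆ S)
    (hB : B ⊆ S) (hA' : ∀ z ∈ A, cross v z ≤ 0) (hB' : ∀ z ∈ B, 0 ≤ cross v z) :
    volume A + volume B ≤ volume S := by
  have hm : MeasurableSet {z | cross v z ≤ 0} :=
    (isClosed_le (continuous_cross_right v) continuous_const).measurableSet
  rw [← measure_inter_add_sdiff S hm]
  refine add_le_add (measure_mono fun z hz => ⟨hA hz, hA' z hz⟩) ?_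
  -- The two parts may share only the separating line, which is null.
  calc volume B ≤ volume ((S \ {z | cross v z ≤ 0}) ∪ {z | cross v z = 0}) := by
        refine measure_mono fun z hz => ?_
        rcases (hB' z hz).eq_or_lt with h | h
        · exact Or.inr h.symm
        · exact Or.inl ⟨hB hz, not_le.2 h⟩
    _ ≤ _ := measure_union_le _ _
    _ = volume (S \ {z | cross v z ≤ 0}) := by rw [volume_line_eq_zero hv, add_zero]

theorem volume_sector_add_le (S : Set Plane) {u v w : Plane} (hv : v ≠ 0) (huw : 0 < cross u w)
    (huv : 0 ≤ cross u v) (hvw : 0 ≤ cross v w) :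
    volume (S ∩ sector u v) + volume (S ∩ sector v w) ≤ volume (S ∩ sector u w) := by
  have hvu : cross v u ≤ 0 := by rw [cross_swap]; linarith
  have hv' := exists_eq_smul_add_smul huw.ne' v
  have p1 : 0 ≤ cross v w / cross u w := by positivity
  have p2 : 0 ≤ cross u v / cross u w := by positivity
  set p := cross v w / cross u w
  set q := cross u v / cross u w
  refine volume_add_le_of_separated hv ?_ ?_ ?_ ?_
  · rintro z ⟨hz, a, b, ha, hb, rfl⟩
    refine ⟨hz, a + b * p, b * q, by positivity, by positivity, ?_⟩
    conv_lhs => rw [hv']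
    module
  · rintro z ⟨hz, a, b, ha, hb, rfl⟩
    refine ⟨hz, a * p, a * q + b, by positivity, by positivity, ?_⟩
    conv_lhs => rw [hv']
    module
  · rintro z ⟨-, a, b, ha, hb, rfl⟩
    rw [cross_smul_add_right, cross_self, mul_zero, add_zero]
    exact mul_nonpos_of_nonneg_of_nonpos ha hvu
  · rintro z ⟨-, a, b, ha, hb, rfl⟩
    rw [cross_smul_add_right, cross_self, mul_zero, zero_add]
    positivity

theorem volume_four_sectors_le (S : Set Plane) {u v : Plane} (huv : 0 < cross u v) :
    (volume (S ∩ sector u v) + volume (S ∩ sector v (-u))) +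
      (volume (S ∩ sector (-u) (-v)) + volume (S ∩ sector (-v) u)) ≤ volume S := by
  have hu : u ≠ 0 := by rintro rfl; simp [cross] at huv
  have hv : v ≠ 0 := by rintro rfl; simp [cross] at huv
  have hvu : cross v u < 0 := by rw [cross_swap]; linarith
  have h1 : volume (S ∩ sector u v) + volume (S ∩ sector v (-u)) ≤
      volume (S ∩ {z | 0 ≤ cross u z}) := by
    refine volume_add_le_of_separated hv ?_ ?_ ?_ ?_
    all_goals rintro z ⟨hz, a, b, ha, hb, rfl⟩
    · refine ⟨hz, ?_⟩
      simp only [mem_ofPred_eq, cross_smul_add_right, cross_self]; nlinarith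
    · refine ⟨hz, ?_⟩
      simp only [mem_ofPred_eq, cross_smul_add_right, cross_neg_right, cross_self]; nlinarith
    · simp only [cross_smul_add_right, cross_self]; nlinarith
    · simp only [cross_smul_add_right, cross_neg_right, cross_self]; nlinarith
  have h2 : volume (S ∩ sector (-u) (-v)) + volume (S ∩ sector (-v) u) ≤
      volume (S ∩ {z | cross u z ≤ 0}) := by
    refine volume_add_le_of_separated (neg_ne_zero.2 hv) ?_ ?_ ?_ ?_
    all_goals rintro z ⟨hz, a, b, ha, hb, rfl⟩
    · refine ⟨hz, ?_⟩
      simp only [mem_ofPred_eq, cross_smul_add_right, cross_neg_right, cross_self]; nlinarith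
    · refine ⟨hz, ?_⟩
      simp only [mem_ofPred_eq, cross_smul_add_right, cross_neg_right, cross_self]; nlinarith
    · simp only [cross_smul_add_right, cross_neg_right, cross_neg_left, cross_self]; nlinarith
    · simp only [cross_smul_add_right, cross_neg_left, cross_self]; nlinarith
  refine (add_le_add h1 h2).trans ?_
  rw [add_comm]
  exact volume_add_le_of_separated hu inter_subset_left inter_subset_left
    (fun z hz => hz.2) (fun z hz => hz.2)

/-- Twice the area of the part of a double cone lying in `S`, counted as the sum of the areas in the
two opposite sectors. -/
noncomputable def sectorArea (S : Set Plane) (u v : Plane) : ℝ :=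
  volume.real (S ∩ sector u v) + volume.real (S ∩ sector (-u) (-v))

theorem sectorArea_add_le {S : Set Plane} (hS : volume S ≠ ⊤) {u v w : Plane} (hv : v ≠ 0)
    (huw : 0 < cross u w) (huv : 0 ≤ cross u v) (hvw : 0 ≤ cross v w) :
    sectorArea S u v + sectorArea S v w ≤ sectorArea S u w := by
  have key : ∀ u v w : Plane, v ≠ 0 → 0 < cross u w → 0 ≤ cross u v → 0 ≤ cross v w →
      volume.real (S ∩ sector u v) + volume.real (S ∩ sector v w) ≤
        volume.real (S ∩ sector u w) := by
    intro u v w hv huw huv hvw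
    have hfin : ∀ T : Set Plane, volume (S ∩ T) ≠ ⊤ := fun T =>
      measure_ne_top_of_subset inter_subset_left hS
    simp only [Measure.real]
    rw [← ENNReal.toReal_add (hfin _) (hfin _)]
    exact ENNReal.toReal_mono (hfin _) (volume_sector_add_le S hv huw huv hvw)
  have a := key u v w hv huw huv hvw
  have b := key (-u) (-v) (-w) (neg_ne_zero.2 hv) (by simpa) (by simpa) (by simpa)
  unfold sectorArea
  linarith

theorem sectorArea_add_le_volume {S : Set Plane} (hS : volume S ≠ ⊤) {u v : Plane}
    (huv : 0 < cross u v) : sectorArea S u v + sectorArea S v (-u) ≤ volume.real S := by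
  have hfin : ∀ T : Set Plane, volume (S ∩ T) ≠ ⊤ := fun T =>
    measure_ne_top_of_subset inter_subset_left hS
  have := ENNReal.toReal_mono hS (volume_four_sectors_le S huv)
  rw [ENNReal.toReal_add (by simp [hfin]) (by simp [hfin]), ENNReal.toReal_add (hfin _) (hfin _),
    ENNReal.toReal_add (hfin _) (hfin _)] at this
  simp only [sectorArea, Measure.real, neg_neg]
  linarith

theorem cross_le_volume_sector {S : Set Plane} (hS : Convex ℝ S) (h0 : (0 : Plane) ∈ S)
    (hfin : volume S ≠ ⊤) {u v : Plane} {a b : ℝ} (ha : 0 < a) (hb : 0 < b) (hu : a • u ∈ S)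
    (hv : b • v ∈ S) : a * b * |cross u v| / 2 ≤ volume.real (S ∩ sector u v) := by
  have h := cross_le_two_mul_volume_sector hS h0 hu hv
  rw [sector_smul ha hb, cross_smul_smul, abs_mul, abs_of_pos (mul_pos ha hb)] at h
  have hf : volume (S ∩ sector u v) ≠ ⊤ := measure_ne_top_of_subset inter_subset_left hfin
  have := ENNReal.toReal_mono (by simp [ENNReal.mul_eq_top, hf]) h
  rw [ENNReal.toReal_ofReal (by positivity), ENNReal.toReal_mul, ENNReal.toReal_ofNat] at this
  simp only [Measure.real]
  linarith

theorem cross_le_sectorArea {S : Set Plane} (hS : Convex ℝ S) (h0 : (0 : Plane) ∈ S)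
    (hfin : volume S ≠ ⊤) {u v : Plane} {a b a' b' : ℝ} (ha : 0 < a) (hb : 0 < b) (ha' : 0 < a')
    (hb' : 0 < b') (hu : a • u ∈ S) (hv : b • v ∈ S) (hu' : -(a' • u) ∈ S) (hv' : -(b' • v) ∈ S) :
    (a * b + a' * b') / 2 * |cross u v| ≤ sectorArea S u v := by
  have h1 := cross_le_volume_sector hS h0 hfin ha hb hu hv
  have h2 := cross_le_volume_sector hS h0 hfin (u := -u) (v := -v) ha' hb' (by rwa [smul_neg])
    (by rwa [smul_neg])
  rw [cross_neg_left, cross_neg_right, neg_neg] at h2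
  unfold sectorArea
  linarith

/-! ### The product inequality in one quadrant. -/

/-- `α u v` behaves like an upper bound of twice the area of the sector of `K` from `u` to `v`. -/
structure IsSectorArea (K : Set (ℝ × ℝ)) (α : ℝ × ℝ → ℝ × ℝ → ℝ) : Prop where
  wedge_le : ∀ u ∈ K, ∀ v ∈ K, u.1 * v.2 - u.2 * v.1 ≤ α u v
  add_le : ∀ u v w : ℝ × ℝ, v ≠ 0 → 0 < u.1 * w.2 - u.2 * w.1 → 0 ≤ u.1 * v.2 - u.2 * v.1 →
    0 ≤ v.1 * w.2 - v.2 * w.1 → α u v + α v w ≤ α u w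

/-- Tangent line of $1/s$ at $1$; it makes the losses caused by $h,k>1$ linear in $h-1$ and $k-1$.
-/
theorem two_sub_le_inv {s : ℝ} (hs : 1 ≤ s) : 2 - s ≤ s⁻¹ := by
  rw [← sub_nonneg]
  have : s⁻¹ - (2 - s) = (s - 1) ^ 2 / s := by field_simp; ring
  rw [this]; positivity

/-- For $h=k=1$ the fan equals $(2xy-t^2)/(xy)$. Larger $h,k$ cost at most $y(h-1)+x(k-1)$ after
multiplication by $xy$, which is the same quantity by which they enlarge the area on the primal
side. -/
theorem three_term_fan_ge {x y h k Y t : ℝ} (hxy : x + y = 1 + t) (ht0 : 0 < t) (hx0 : 0 < x)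
    (hy0 : 0 < y) (hx : x ≤ 1) (hy : y ≤ 1) (hh : 1 ≤ h) (hk : 1 ≤ k)
    (hY : (1 - x) / (y * h) + (1 - y) / (x * k) + t / (x * y * (h * k)) ≤ Y) :
    2 * (x * y) - t ^ 2 - (y * (h - 1) + x * (k - 1)) ≤ Y * (x * y) := by
  have a1 : x * (1 - x) * (2 - h) ≤ x * (1 - x) * h⁻¹ := by
    apply mul_le_mul_of_nonneg_left (two_sub_le_inv hh)
    exact mul_nonneg hx0.le (by linarith)
  have a2 : y * (1 - y) * (2 - k) ≤ y * (1 - y) * k⁻¹ := by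
    apply mul_le_mul_of_nonneg_left (two_sub_le_inv hk)
    exact mul_nonneg hy0.le (by linarith)
  have a3 : t * (1 - (h - 1) - (k - 1)) ≤ t * (h⁻¹ * k⁻¹) := by
    apply mul_le_mul_of_nonneg_left _ ht0.le
    have i1 := two_sub_le_inv hh
    have i2 := two_sub_le_inv hk
    have j1 : 0 ≤ (1 - h⁻¹) * (1 - k⁻¹) :=
      mul_nonneg (sub_nonneg.2 (inv_le_one_of_one_le₀ hh)) (sub_nonneg.2 (inv_le_one_of_one_le₀ hk))
    linarith
  have a4 : ((1 - x) / (y * h) + (1 - y) / (x * k) + t / (x * y * (h * k))) * (x * y)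
      ≤ Y * (x * y) := by gcongr
  have a5 : ((1 - x) / (y * h) + (1 - y) / (x * k) + t / (x * y * (h * k))) * (x * y)
      = x * (1 - x) * h⁻¹ + y * (1 - y) * k⁻¹ + t * (h⁻¹ * k⁻¹) := by
    have : h ≠ 0 := by positivity
    have : k ≠ 0 := by positivity
    field_simp
  have a6 : x * (1 - x) * (2 - h) + y * (1 - y) * (2 - k) + t * (1 - (h - 1) - (k - 1))
      = 2 * (x * y) - t ^ 2 - (h - 1) * (y - (1 - x) ^ 2) - (k - 1) * (x - (1 - y) ^ 2) := by
    obtain rfl : t = x + y - 1 := by linarith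
    ring
  have a7 : 0 ≤ (h - 1) * (1 - x) ^ 2 := mul_nonneg (by linarith) (sq_nonneg _)
  have a8 : 0 ≤ (k - 1) * (1 - y) ^ 2 := mul_nonneg (by linarith) (sq_nonneg _)
  linarith

/-- Here $F$ stands for $XY-2$ and $g$ for the gain from $h,k$. With $t\le xy$, the fan bound gives
an excess $t(1-t)$ minus a multiple of $g$, while `hF1` bounds $g$ by $F$. Absorbing $g$ costs the
factor $5$, because $(x+y)^2\le 8xy$ when $y\le x\le 4y$. -/
theorem excess_ge_of_balanced {x y g F Y t : ℝ} (hxy : x + y = 1 + t) (ht0 : 0 < t) (hx0 : 0 < x)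
    (hy0 : 0 < y) (hx : x ≤ 1) (hy : y ≤ 1) (hyx : y ≤ x) (hc : x ≤ 4 * y) (hF0 : 0 ≤ F)
    (hF1 : 2 * g ≤ F * (x + y)) (hFY : (x + y) * Y - 2 ≤ F)
    (key : 2 * (x * y) - t ^ 2 - g ≤ Y * (x * y)) : t * (1 - t) / 5 ≤ F := by
  have hxy0 : 0 < x * y := by positivity
  have htxy : t ≤ x * y := by nlinarith [mul_nonneg (sub_nonneg.2 hx) (sub_nonneg.2 hy)]
  have hF2 : (x * y) * (t * (1 - t)) - (x + y) * g ≤ F * (x * y) := by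
    have b1 : ((x + y) * Y - 2) * (x * y) ≤ F * (x * y) := by gcongr
    have b2 : (x + y) * (2 * (x * y) - t ^ 2 - g) ≤ (x + y) * (Y * (x * y)) := by gcongr
    have b3 : (1 + t) * t * t ≤ (1 + t) * t * (x * y) := by gcongr
    rw [hxy] at b1 b2 ⊢
    linarith
  have hF3 : (x + y) * g ≤ F * ((x + y) ^ 2 / 2) := by
    have := mul_le_mul_of_nonneg_left hF1 (by linarith : 0 ≤ x + y)
    linarith
  have hF4 : F * (x * y + (x + y) ^ 2 / 2) ≤ F * (5 * (x * y)) := by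
    apply mul_le_mul_of_nonneg_left _ hF0
    have := mul_le_mul_of_nonneg_left hc hx0.le
    have := mul_le_mul_of_nonneg_left hyx hy0.le
    linarith
  have hF5 : (x * y) * (t * (1 - t)) ≤ (x * y) * (5 * F) := by linarith
  have := le_of_mul_le_mul_left hF5 hxy0
  linarith

/-- When $y$ is small compared with $x$, absorbing the loss as in the balanced case is too
expensive. The single normal with denominator $k$ already suffices: its coordinate sum is
$(2-t/x)/k$. -/
theorem excess_ge_of_unbalanced {x y k F Y t : ℝ} (hxy : x + y = 1 + t) (ht0 : 0 < t)
    (hx0 : 0 < x) (hx : x ≤ 1) (hc : 4 * y ≤ x) (hk : 1 ≤ k)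
    (hF0 : 0 ≤ F) (hF1 : 2 * (x * (k - 1)) ≤ F * (x + y)) (hFY : (x + y) * Y - 2 ≤ F)
    (hY : (1 + (1 - y) / x) / k ≤ Y) : t * (1 - t) / 5 ≤ F := by
  have hb : 1 + (1 - y) / x = 2 - t / x := by
    obtain rfl : t = x + y - 1 := by linarith
    field_simp; ring
  rw [hb] at hY
  have htx : t / x ≤ 1 := by rw [div_le_one hx0]; linarith
  have htx0 : 0 ≤ t / x := by positivity
  have hk0 : 0 ≤ k - 1 := by linarith
  have c1 : 2 - t / x - 2 * (k - 1) ≤ Y := by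
    have := mul_le_mul_of_nonneg_left (two_sub_le_inv hk) (by linarith : 0 ≤ 2 - t / x)
    rw [div_eq_mul_inv] at hY
    have := mul_nonneg htx0 hk0
    linarith
  have c2 : (x + y) * (2 - t / x) - 2 = t * (1 - y / x) := by
    obtain rfl : t = x + y - 1 := by linarith
    field_simp; ring
  have c3 : y / x ≤ 1 / 4 := by rw [div_le_iff₀ hx0]; linarith
  have c4 : t * (3 / 4) ≤ t * (1 - y / x) := mul_le_mul_of_nonneg_left (by linarith) ht0.le
  have c5 : (x + y) * (2 - t / x - 2 * (k - 1)) ≤ (x + y) * Y :=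
    mul_le_mul_of_nonneg_left c1 (by linarith)
  have c6 : (x + y) * (k - 1) ≤ 5 / 4 * (k - 1) := mul_le_mul_of_nonneg_right (by linarith) hk0
  have c7 : x * (2 * (k - 1)) ≤ x * (5 / 4 * F) := by
    have : F * (x + y) ≤ F * (5 / 4 * x) := mul_le_mul_of_nonneg_left (by linarith) hF0
    linarith
  have c8 := le_of_mul_le_mul_left c7 hx0
  have c9 : 0 ≤ t * t := mul_self_nonneg t
  linarith

theorem mul_ge_of_fan_bounds {x y h k X Y : ℝ} (ht : 1 < x + y) (hx : x ≤ 1) (hy : y ≤ 1)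
    (hyx : y ≤ x) (hh : 1 ≤ h) (hk : 1 ≤ k) (hX : y * h + x * k ≤ X) (hY : 2 / (x + y) ≤ Y)
    (hY₁ : (1 - x) / (y * h) + (1 - y) / (x * k) + (x + y - 1) / (x * y * (h * k)) ≤ Y)
    (hY₂ : (1 + (1 - y) / x) / k ≤ Y) :
    2 + (x + y - 1) * (1 - (x + y - 1)) / 5 ≤ X * Y := by
  have hx0 : 0 < x := by linarith
  have hy0 : 0 < y := by linarith
  have hm : 0 < x + y := by linarith
  have hY0 : 0 < Y := lt_of_lt_of_le (by positivity) hY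
  have hg1 : 0 ≤ y * (h - 1) := mul_nonneg hy0.le (by linarith)
  have hg2 : 0 ≤ x * (k - 1) := mul_nonneg hx0.le (by linarith)
  have hF1 : 2 * (y * (h - 1) + x * (k - 1)) ≤ (X * Y - 2) * (x + y) := by
    have h1 : 2 ≤ Y * (x + y) := by rwa [div_le_iff₀ hm] at hY
    have h2 := mul_le_mul_of_nonneg_right hX (by positivity : 0 ≤ Y * (x + y))
    have h3 := mul_le_mul_of_nonneg_left h1
      (by positivity : 0 ≤ x + y + (y * (h - 1) + x * (k - 1)))
    linarith
  have hF0 : 0 ≤ X * Y - 2 := by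
    by_contra hneg
    have : (X * Y - 2) * (x + y) < 0 := mul_neg_of_neg_of_pos (not_le.1 hneg) hm
    linarith
  have hFY : (x + y) * Y - 2 ≤ X * Y - 2 := by
    have : (x + y) * Y ≤ X * Y := mul_le_mul_of_nonneg_right (by linarith) hY0.le
    linarith
  have hxy : x + y = 1 + (x + y - 1) := by ring
  rcases le_total x (4 * y) with hc | hc
  · have := excess_ge_of_balanced hxy (by linarith) hx0 hy0 hx hy hyx hc hF0 hF1 hFY
      (three_term_fan_ge hxy (by linarith) hx0 hy0 hx hy hh hk hY₁)
    linarith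
  · have := excess_ge_of_unbalanced hxy (by linarith) hx0 hx hc hk hF0 (by linarith) hFY hY₂
    linarith

/-- If `r` is beyond the edge from `e₁` to the point `p` maximizing the sum of the coordinates,
then `r` is in the sector between `e₁` and `p`. -/
theorem wedge_nonneg_of_beyond_edge {x y r s : ℝ} (ht : 1 < x + y) (hx : x ≤ 1) (hy : 0 < y)
    (hr : r ≤ 1) (hrs : r + s ≤ x + y) (h : 1 < r + (1 - x) / y * s) :
    0 ≤ s ∧ 0 ≤ r * y - s * x := by
  have h' : y < r * y + (1 - x) * s := by
    have := mul_lt_mul_of_pos_right h hy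
    have e : (r + (1 - x) / y * s) * y = r * y + (1 - x) * s := by field_simp
    linarith
  have hs : 0 ≤ s := by
    by_contra hs
    have : (1 - x) * s ≤ 0 := mul_nonpos_of_nonneg_of_nonpos (by linarith) (by linarith)
    nlinarith
  refine ⟨hs, ?_⟩
  by_contra hneg
  -- Past the ray of $p$ the second coordinate exceeds $y$. Since $(1-x)/y<1$ and $r+s\le x+y$, the
  -- functional of the edge is then below its value $1$ at $p$.
  have h1 : y < s := by nlinarith
  nlinarith [mul_pos (sub_pos.2 h1) (sub_pos.2 ht)]

/-- The functional is $1$ on the line through $(1,0)$ and $(x,y)$, and $r$ is the point of $K$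
farthest beyond that line. Its position in the sector of this edge allows a fan of triangles through
$(1,0)$, $r$, $(x,y)$. If nothing of $K$ is beyond the line, $(x,y)$ itself serves. -/
theorem exists_extremal_beyond_edge {K : Set (ℝ × ℝ)} (hK : IsCompact K)
    (hbox : ∀ z ∈ K, z.1 ≤ 1 ∧ z.2 ≤ 1) {x y : ℝ} (hp : (x, y) ∈ K)
    (hmax : ∀ z ∈ K, z.1 + z.2 ≤ x + y) (ht : 1 < x + y) :
    ∃ r ∈ K, (∀ z ∈ K, z.1 + (1 - x) / y * z.2 ≤ r.1 + (1 - x) / y * r.2) ∧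
      1 ≤ r.1 + (1 - x) / y * r.2 ∧ 0 ≤ r.2 ∧ 0 ≤ r.1 * y - r.2 * x := by
  have hx := (hbox _ hp).1
  have hy := (hbox _ hp).2
  simp only at hx hy
  have hy0 : 0 < y := by linarith
  obtain ⟨r, hr, hrmax⟩ := hK.exists_isMaxOn ⟨_, hp⟩
    (f := fun z : ℝ × ℝ => z.1 + (1 - x) / y * z.2) (by fun_prop)
  have hrmax' : ∀ z ∈ K, z.1 + (1 - x) / y * z.2 ≤ r.1 + (1 - x) / y * r.2 := fun z hz => hrmax hz
  have hpe : x + (1 - x) / y * y = 1 := by field_simp; ring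
  have h1 := hrmax' _ hp
  simp only [hpe] at h1
  rcases h1.eq_or_lt with h | h
  · refine ⟨(x, y), hp, ?_, by simp [hpe], hy0.le, by simp [mul_comm]⟩
    intro z hz
    simp only [hpe]
    exact (hrmax' z hz).trans h.ge
  · exact ⟨r, hr, hrmax', h1,
      wedge_nonneg_of_beyond_edge ht hx hy0 (hbox r hr).1 (hmax r hr) h⟩

/-- On the primal side the fan runs through $(1,0)$, $r$, $p$, the swap of $s$ and $(0,1)$, where
$p=(x,y)$ maximizes the coordinate sum and $r,s$ are extremal beyond the two edges at $p$. On the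
dual side it runs through the normals of these edges, divided by the maxima $h,k$ so that they
belong to $L$. -/
theorem quadrant_bound {K L : Set (ℝ × ℝ)} {α β : ℝ × ℝ → ℝ × ℝ → ℝ} (hK : IsCompact K)
    (hbox : ∀ z ∈ K, z.1 ≤ 1 ∧ z.2 ≤ 1) (hK₁ : ((1, 0) : ℝ × ℝ) ∈ K) (hK₂ : ((0, 1) : ℝ × ℝ) ∈ K)
    (hL₁ : ((1, 0) : ℝ × ℝ) ∈ L) (hL₂ : ((0, 1) : ℝ × ℝ) ∈ L)
    (hpol : ∀ n : ℝ × ℝ, (∀ z ∈ K, n.1 * z.1 + n.2 * z.2 ≤ 1) → n ∈ L)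
    (hα : IsSectorArea K α) (hβ : IsSectorArea L β) :
    ∃ t : ℝ, 0 ≤ t ∧ t ≤ 1 ∧ (∀ z ∈ K, z.1 + z.2 ≤ 1 + t) ∧ 1 + t ≤ α (1, 0) (0, 1) ∧
      1 ≤ β (1, 0) (0, 1) ∧ 2 + t * (1 - t) / 5 ≤ α (1, 0) (0, 1) * β (1, 0) (0, 1) := by
  obtain ⟨⟨x, y⟩, hp, hpmax⟩ := hK.exists_isMaxOn ⟨_, hK₁⟩
    (f := fun z : ℝ × ℝ => z.1 + z.2) (by fun_prop)
  have hmax : ∀ z ∈ K, z.1 + z.2 ≤ x + y := fun z hz => hpmax hz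
  have hx := (hbox _ hp).1
  have hy := (hbox _ hp).2
  simp only at hx hy
  have ht0 : 1 ≤ x + y := by simpa using hmax _ hK₁
  have hx0 : 0 ≤ x := by linarith
  have hy0 : 0 ≤ y := by linarith
  have hY1 : 1 ≤ β (1, 0) (0, 1) := by simpa using hβ.wedge_le _ hL₁ _ hL₂
  have fanL : ∀ n ∈ L, n ≠ 0 → 0 ≤ n.1 → 0 ≤ n.2 → n.1 + n.2 ≤ β (1, 0) (0, 1) := by
    intro n hn hn0 h1 h2
    have a := hβ.add_le (1, 0) n (0, 1) hn0 (by simp) (by simpa) (by simpa)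
    have b := hβ.wedge_le _ hL₁ _ hn
    have c := hβ.wedge_le _ hn _ hL₂
    simp only at b c
    linarith
  have hne : ((x, y) : ℝ × ℝ) ≠ 0 := by
    rintro h
    simp only [Prod.mk_eq_zero] at h
    linarith [h.1, h.2]
  have hXsplit : α (1, 0) (x, y) + α (x, y) (0, 1) ≤ α (1, 0) (0, 1) :=
    hα.add_le _ _ _ hne (by simp) (by simpa) (by simpa)
  have hX1 : x + y ≤ α (1, 0) (0, 1) := by
    have b := hα.wedge_le _ hK₁ _ hp
    have c := hα.wedge_le _ hp _ hK₂
    simp only at b c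
    linarith
  have hY : 2 / (x + y) ≤ β (1, 0) (0, 1) := by
    have hm : 0 < x + y := by linarith
    have := fanL (1 / (x + y), 1 / (x + y)) (hpol _ ?_) ?_ (by positivity) (by positivity)
    · calc 2 / (x + y) = 1 / (x + y) + 1 / (x + y) := by ring
        _ ≤ _ := this
    · intro z hz
      have := hmax z hz
      simp only
      rw [← mul_add, one_div_mul_eq_div, div_le_one hm]
      exact this
    · intro h
      simp only [Prod.mk_eq_zero] at h
      have : 0 < 1 / (x + y) := by positivity
      linarith [h.1]
  refine ⟨x + y - 1, by linarith, by linarith, fun z hz => by linarith [hmax z hz], by linarith,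
    hY1, ?_⟩
  -- If $x+y=1$, a coordinate of $p$ may vanish and the edge normals may be undefined; then $X\ge1$
  -- and $Y\ge2$ suffice.
  rcases ht0.eq_or_lt with ht | ht
  · rw [← ht] at hY ⊢
    simp only [sub_self, zero_mul, zero_div, add_zero]
    rw [div_one] at hY
    nlinarith
  have hx0 : 0 < x := by linarith
  have hy0 : 0 < y := by linarith
  obtain ⟨r, hr, hrmax, hr1, hr2, hr3⟩ := exists_extremal_beyond_edge hK hbox hp hmax ht
  -- The edge from $p$ to $(0,1)$ is treated in the body reflected in the diagonal.
  obtain ⟨s, hs, hsmax, hs1, hs2, hs3⟩ := exists_extremal_beyond_edge (K := Prod.swap ⁻¹' K)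
    (x := y) (y := x)
    (hK.image_of_continuousOn (f := Prod.swap) (by fun_prop) |> fun h => by
      rwa [image_swap_eq_preimage_swap] at h)
    (fun z hz => (hbox _ hz).symm) hp (fun z hz => by
      have := hmax _ hz
      simp only [Prod.fst_swap, Prod.snd_swap] at this; linarith) (by linarith)
  set h := r.1 + (1 - x) / y * r.2 with hh
  set k := s.1 + (1 - y) / x * s.2 with hk
  have hX : y * h + x * k ≤ α (1, 0) (0, 1) := by
    have r0 : r ≠ 0 := by
      rintro rfl
      simp at hh; linarith
    have s0 : s.swap ≠ 0 := by
      rintro h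
      have h1 := congrArg Prod.fst h
      have h2 := congrArg Prod.snd h
      simp at h1 h2
      rw [h1, h2] at hk
      linarith
    have a1 := hα.add_le (1, 0) r (x, y) r0 (by simpa) (by simpa) (by simpa using hr3)
    have a2 := hα.add_le (x, y) s.swap (0, 1) s0 (by simpa)
      (by simp only [Prod.fst_swap, Prod.snd_swap]; linarith) (by simpa)
    have b1 := hα.wedge_le _ hK₁ _ hr
    have b2 := hα.wedge_le _ hr _ hp
    have b3 := hα.wedge_le _ hp _ hs
    have b4 := hα.wedge_le _ hs _ hK₂
    simp only [Prod.fst_swap, Prod.snd_swap] at b1 b2 b3 b4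
    have c1 : y * h = r.1 * y + (1 - x) * r.2 := by rw [hh]; field_simp
    have c2 : x * k = s.1 * x + (1 - y) * s.2 := by rw [hk]; field_simp
    rw [c1, c2]
    linarith
  have hh0 : 0 < h := by linarith
  have hk0 : 0 < k := by linarith
  have ha : 0 ≤ (1 - x) / y := div_nonneg (by linarith) hy0.le
  have hb : 0 ≤ (1 - y) / x := div_nonneg (by linarith) hx0.le
  have hn : (1 / h, (1 - x) / y / h) ∈ L := by
    refine hpol _ fun z hz => ?_
    have := hrmax z hz
    rw [show 1 / h * z.1 + (1 - x) / y / h * z.2 = (z.1 + (1 - x) / y * z.2) / h by ring,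
      div_le_one hh0]
    exact this
  have hn' : ((1 - y) / x / k, 1 / k) ∈ L := by
    refine hpol _ fun z hz => ?_
    have := hsmax z.swap (by simpa using hz)
    simp only [Prod.fst_swap, Prod.snd_swap] at this
    rw [show (1 - y) / x / k * z.1 + 1 / k * z.2 = (z.2 + (1 - y) / x * z.1) / k by ring,
      div_le_one hk0]
    exact this
  have hn0 : ((1 / h, (1 - x) / y / h) : ℝ × ℝ) ≠ 0 := by
    intro h'
    simp only [Prod.mk_eq_zero] at h'
    have : 0 < 1 / h := by positivity
    linarith [h'.1]
  have hn0' : (((1 - y) / x / k, 1 / k) : ℝ × ℝ) ≠ 0 := by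
    intro h'
    simp only [Prod.mk_eq_zero] at h'
    have : 0 < 1 / k := by positivity
    linarith [h'.2]
  have hY₁ := fanL _ hn hn0 (by positivity) (by positivity)
  have hY₂ := fanL _ hn' hn0' (by positivity) (by positivity)
  simp only at hY₁ hY₂
  have hY₃ : (1 - x) / (y * h) + (1 - y) / (x * k) + (x + y - 1) / (x * y * (h * k))
      ≤ β (1, 0) (0, 1) := by
    have hw : 1 / h * (1 / k) - (1 - x) / y / h * ((1 - y) / x / k)
        = (x + y - 1) / (x * y * (h * k)) := by
      field_simp; ring
    have hw0 : 0 ≤ (x + y - 1) / (x * y * (h * k)) := by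
      apply div_nonneg (by linarith); positivity
    have a1 := hβ.add_le (1, 0) (1 / h, (1 - x) / y / h) (0, 1) hn0 (by simp)
      (by simp only [one_mul, zero_mul, sub_zero]; positivity)
      (by simp only [mul_one, mul_zero, sub_zero]; positivity)
    have a2 := hβ.add_le (1 / h, (1 - x) / y / h) ((1 - y) / x / k, 1 / k) (0, 1) hn0'
      (by simp only [mul_one, mul_zero, sub_zero]; positivity)
      (by simp only [hw]; exact hw0)
      (by simp only [mul_one, mul_zero, sub_zero]; positivity)
    have b1 := hβ.wedge_le _ hL₁ _ hn
    have b2 := hβ.wedge_le _ hn _ hn'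
    have b3 := hβ.wedge_le _ hn' _ hL₂
    simp only at b1 b2 b3
    rw [hw] at b2
    have d1 : (1 - x) / (y * h) = (1 - x) / y / h := by rw [div_div]
    have d2 : (1 - y) / (x * k) = (1 - y) / x / k := by rw [div_div]
    rw [d1, d2]
    linarith
  rcases le_total y x with hyx | hxy
  · exact mul_ge_of_fan_bounds ht hx hy hyx hr1 hs1 hX hY hY₃
      (by rw [add_div]; linarith)
  · have := mul_ge_of_fan_bounds (x := y) (y := x) (X := α (1, 0) (0, 1)) (Y := β (1, 0) (0, 1))
      (by linarith) hy hx hxy hs1 hr1 (by linarith) (by rwa [add_comm y x])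
      (by rw [add_comm y x, mul_comm y x, mul_comm k h]; linarith)
      (by rw [add_div]; linarith)
    rwa [add_comm y x] at this

/-! ### From quadrants to the dichotomy. -/

/-- A quarter turn carries the second quadrant to the first; the other two quadrants are opposite to
these and need no separate treatment. -/
theorem IsSectorArea.rotate {K : Set (ℝ × ℝ)} {α : ℝ × ℝ → ℝ × ℝ → ℝ} (hα : IsSectorArea K α) :
    IsSectorArea {z | (-z.2, z.1) ∈ K} (fun u v => α (-u.2, u.1) (-v.2, v.1)) where
  wedge_le u hu v hv := by
    have := hα.wedge_le _ hu _ hv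
    simp only at this ⊢
    linarith
  add_le u v w hv h1 h2 h3 := by
    apply hα.add_le
    · intro h
      simp only [Prod.mk_eq_zero, neg_eq_zero] at h
      exact hv (Prod.ext h.2 h.1)
    all_goals simp only; linarith

/-- The dichotomy behind the stability of the planar volume product: a symmetric body between the
`ℓ¹` ball and the `ℓ^∞` ball with almost minimal volume product is close to one of the two. -/
theorem close_to_ball_of_sector_mul_le {K L : Set (ℝ × ℝ)} {α β : ℝ × ℝ → ℝ × ℝ → ℝ}
    (hK : IsCompact K) (hL : IsCompact L) (hKs : ∀ z ∈ K, -z ∈ K) (hLs : ∀ z ∈ L, -z ∈ L)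
    (hKbox : ∀ z ∈ K, z.1 ≤ 1 ∧ z.2 ≤ 1) (hLbox : ∀ z ∈ L, z.1 ≤ 1 ∧ z.2 ≤ 1)
    (hK₁ : ((1, 0) : ℝ × ℝ) ∈ K) (hK₂ : ((0, 1) : ℝ × ℝ) ∈ K)
    (hL₁ : ((1, 0) : ℝ × ℝ) ∈ L) (hL₂ : ((0, 1) : ℝ × ℝ) ∈ L)
    (hKL : ∀ n : ℝ × ℝ, (∀ z ∈ K, n.1 * z.1 + n.2 * z.2 ≤ 1) → n ∈ L)
    (hLK : ∀ n : ℝ × ℝ, (∀ z ∈ L, n.1 * z.1 + n.2 * z.2 ≤ 1) → n ∈ K)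
    (hα : IsSectorArea K α) (hβ : IsSectorArea L β) {ε : ℝ} (hε : 0 < ε)
    (hvol : (α (1, 0) (0, 1) + α (0, 1) (-1, 0)) * (β (1, 0) (0, 1) + β (0, 1) (-1, 0))
      ≤ 8 * (1 + ε)) :
    (∀ z ∈ K, |z.1| + |z.2| ≤ 1 + 200 * ε) ∨ (∀ z ∈ L, |z.1| + |z.2| ≤ 1 + 200 * ε) := by
  have rot_compact : ∀ S : Set (ℝ × ℝ), IsCompact S → IsCompact {z : ℝ × ℝ | (-z.2, z.1) ∈ S} := by
    intro S hS
    have := hS.image (f := fun z : ℝ × ℝ => (z.2, -z.1)) (by fun_prop)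
    convert this using 1
    ext z
    simp only [mem_ofPred_eq, mem_image]
    constructor
    · intro h
      exact ⟨_, h, by simp⟩
    · rintro ⟨w, hw, rfl⟩
      simpa using hw
  have rot_box : ∀ S : Set (ℝ × ℝ), (∀ z ∈ S, -z ∈ S) → (∀ z ∈ S, z.1 ≤ 1 ∧ z.2 ≤ 1) →
      ∀ z ∈ {z : ℝ × ℝ | (-z.2, z.1) ∈ S}, z.1 ≤ 1 ∧ z.2 ≤ 1 := by
    intro S hs hb z hz
    exact ⟨(hb _ hz).2, by simpa using (hb _ (hs _ hz)).1⟩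
  have rot_pol : ∀ S T : Set (ℝ × ℝ), (∀ n : ℝ × ℝ, (∀ z ∈ S, n.1 * z.1 + n.2 * z.2 ≤ 1) → n ∈ T) →
      ∀ n : ℝ × ℝ, (∀ z ∈ {z : ℝ × ℝ | (-z.2, z.1) ∈ S}, n.1 * z.1 + n.2 * z.2 ≤ 1) →
        n ∈ {z : ℝ × ℝ | (-z.2, z.1) ∈ T} := by
    intro S T h n hn
    refine h _ fun z hz => ?_
    have := hn (z.2, -z.1) (by simpa using hz)
    simp only at this ⊢
    linarith
  have hK₃ : ((-1, 0) : ℝ × ℝ) ∈ K := by simpa using hKs _ hK₁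
  have hL₃ : ((-1, 0) : ℝ × ℝ) ∈ L := by simpa using hLs _ hL₁
  obtain ⟨t₁, p₁, q₁, m₁, X₁, -, E₁⟩ := quadrant_bound hK hKbox hK₁ hK₂ hL₁ hL₂ hKL hα hβ
  obtain ⟨s₁, p₁', q₁', m₁', Y₁, -, E₁'⟩ := quadrant_bound hL hLbox hL₁ hL₂ hK₁ hK₂ hLK hβ hα
  obtain ⟨t₂, p₂, q₂, m₂, X₂, -, E₂⟩ := quadrant_bound (rot_compact K hK) (rot_box K hKs hKbox)
    (by simpa using hK₂) (by simpa using hK₃) (by simpa using hL₂) (by simpa using hL₃)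
    (rot_pol K L hKL) hα.rotate hβ.rotate
  obtain ⟨s₂, p₂', q₂', m₂', Y₂, -, E₂'⟩ := quadrant_bound (rot_compact L hL) (rot_box L hLs hLbox)
    (by simpa using hL₂) (by simpa using hL₃) (by simpa using hK₂) (by simpa using hK₃)
    (rot_pol L K hLK) hβ.rotate hα.rotate
  simp only [neg_zero] at X₂ Y₂ E₂ E₂'
  have abs_le_of : ∀ S : Set (ℝ × ℝ), (∀ z ∈ S, -z ∈ S) → ∀ a b : ℝ,
      (∀ z ∈ S, z.1 + z.2 ≤ 1 + a) →
      (∀ z ∈ {z : ℝ × ℝ | (-z.2, z.1) ∈ S}, z.1 + z.2 ≤ 1 + b) →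
      a ≤ 200 * ε → b ≤ 200 * ε → ∀ z ∈ S, |z.1| + |z.2| ≤ 1 + 200 * ε := by
    intro S hs a b ha hb ha' hb' z hz
    have h1 := ha _ hz
    have h2 := ha _ (hs _ hz)
    have h3 := hb (z.2, -z.1) (by simpa using hz)
    have h4 := hb (-z.2, z.1) (hs z hz)
    simp only [Prod.fst_neg, Prod.snd_neg] at h1 h2 h3 h4
    rcases abs_cases z.1 with ⟨e, _⟩ | ⟨e, _⟩ <;> rcases abs_cases z.2 with ⟨e', _⟩ | ⟨e', _⟩ <;>
      rw [e, e'] <;> linarith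
  set a₁ := α (1, 0) (0, 1)
  set a₂ := α (0, 1) (-1, 0)
  set b₁ := β (1, 0) (0, 1)
  set b₂ := β (0, 1) (-1, 0)
  have P₁ : 2 ≤ a₁ * b₁ := by nlinarith
  have P₂ : 2 ≤ a₂ * b₂ := by nlinarith
  -- The arithmetic-geometric mean inequality for the mixed products, whose product is at least $4$.
  -- Each diagonal product is left with at most $2+8\varepsilon$.
  have hS : 4 ≤ a₁ * b₂ + a₂ * b₁ := by
    have h0 : 0 ≤ a₁ * b₂ + a₂ * b₁ := by
      have : 0 ≤ a₁ := by linarith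
      have : 0 ≤ a₂ := by linarith
      have : 0 ≤ b₁ := by linarith
      have : 0 ≤ b₂ := by linarith
      positivity
    have h1 : 2 * 2 ≤ (a₁ * b₁) * (a₂ * b₂) := by gcongr
    have h2 : (4 : ℝ) ^ 2 ≤ (a₁ * b₂ + a₂ * b₁) ^ 2 := by
      nlinarith [sq_nonneg (a₁ * b₂ - a₂ * b₁)]
    exact le_of_sq_le_sq h2 h0
  have U₁ : a₁ * b₁ ≤ 2 + 8 * ε := by nlinarith
  have U₂ : a₂ * b₂ ≤ 2 + 8 * ε := by nlinarith
  -- The source of $200$: the bounds give $t(1-t)\le40\varepsilon$, whereas $200\varepsilon<t<0.8$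
  -- gives $t(1-t)>200\varepsilon\cdot0.2$.
  have big : ∀ t P : ℝ, t ≤ 1 → 2 + t * (1 - t) / 5 ≤ P → P ≤ 2 + 8 * ε → 200 * ε < t →
      0.8 ≤ t := by
    intro t P h0 h1 h2 h3
    by_contra h
    push Not at h
    nlinarith
  by_contra hcon
  push Not at hcon
  obtain ⟨⟨z, hz, hzb⟩, ⟨w, hw, hwb⟩⟩ := hcon
  have hε1 : 200 * ε < 1 := by
    have c1 := hKbox _ hz
    have c2 := hKbox _ (hKs _ hz)
    simp only [Prod.fst_neg, Prod.snd_neg] at c2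
    have : |z.1| ≤ 1 := abs_le.2 ⟨by linarith, c1.1⟩
    have : |z.2| ≤ 1 := abs_le.2 ⟨by linarith, c1.2⟩
    linarith
  have hT : 0.8 ≤ t₁ ∨ 0.8 ≤ t₂ := by
    by_contra h
    push Not at h
    refine absurd (abs_le_of K hKs t₁ t₂ m₁ m₂ ?_ ?_ z hz) (not_le.2 hzb)
    · by_contra h'
      exact absurd (big t₁ _ q₁ E₁ U₁ (not_le.1 h')) (not_le.2 h.1)
    · by_contra h'
      exact absurd (big t₂ _ q₂ E₂ U₂ (not_le.1 h')) (not_le.2 h.2)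
  have hT' : 0.8 ≤ s₁ ∨ 0.8 ≤ s₂ := by
    by_contra h
    push Not at h
    refine absurd (abs_le_of L hLs s₁ s₂ m₁' m₂' ?_ ?_ w hw) (not_le.2 hwb)
    · by_contra h'
      exact absurd (big s₁ _ q₁' E₁' (by linarith) (not_le.1 h')) (not_le.2 h.1)
    · by_contra h'
      exact absurd (big s₂ _ q₂' E₂' (by linarith) (not_le.1 h')) (not_le.2 h.2)
  have mul_big : ∀ a b c d : ℝ, c ≤ a → d ≤ b → 0 ≤ c → 0 ≤ d → c * d ≤ a * b :=
    fun a b c d h1 h2 h3 h4 => mul_le_mul h1 h2 h4 (h3.trans h1)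
  -- If both large values occur in the same quadrant, $1.8^2=3.24$ exceeds $2+8\varepsilon$.
  -- Otherwise the mixed terms are at least $3.24+1$, above the available $4+8\varepsilon$; recall
  -- $8\varepsilon<0.04$.
  rcases hT with h | h <;> rcases hT' with h' | h'
  · have := mul_big a₁ b₁ 1.8 1.8 (by linarith) (by linarith) (by norm_num) (by norm_num)
    linarith
  · have := mul_big a₁ b₂ 1.8 1.8 (by linarith) (by linarith) (by norm_num) (by norm_num)
    have := mul_big a₂ b₁ 1 1 (by linarith) (by linarith) (by norm_num) (by norm_num)
    linarith
  · have := mul_big a₂ b₁ 1.8 1.8 (by linarith) (by linarith) (by norm_num) (by norm_num)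
    have := mul_big a₁ b₂ 1 1 (by linarith) (by linarith) (by norm_num) (by norm_num)
    linarith
  · have := mul_big a₂ b₂ 1.8 1.8 (by linarith) (by linarith) (by norm_num) (by norm_num)
    linarith

/-! ### Coordinates, duality and the parallelogram near a centred body. -/

theorem mem_of_mem_bipolar {K : Set (ℝ × ℝ)} (hK : IsClosed K) (hconv : Convex ℝ K)
    (h0 : (0 : ℝ × ℝ) ∈ K) {p : ℝ × ℝ}
    (hp : ∀ n : ℝ × ℝ, (∀ z ∈ K, n.1 * z.1 + n.2 * z.2 ≤ 1) → p.1 * n.1 + p.2 * n.2 ≤ 1) :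
    p ∈ K := by
  by_contra hpK
  obtain ⟨f, c, hc, hcp⟩ := geometric_hahn_banach_closed_point hconv hK hpK
  have hc0 : 0 < c := by simpa using hc 0 h0
  have hf : ∀ z : ℝ × ℝ, f z = f (1, 0) * z.1 + f (0, 1) * z.2 := by
    intro z
    have : z = z.1 • (1, 0) + z.2 • (0, 1) := by ext <;> simp
    conv_lhs => rw [this]
    rw [map_add, map_smul, map_smul, smul_eq_mul, smul_eq_mul]
    ring
  have := hp (f (1, 0) / c, f (0, 1) / c) fun z hz => by
    have h := (hc z hz).le
    rw [hf] at h
    calc f (1, 0) / c * z.1 + f (0, 1) / c * z.2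
        = (f (1, 0) * z.1 + f (0, 1) * z.2) / c := by ring
      _ ≤ 1 := (div_le_one hc0).2 h
  rw [hf] at hcp
  have h' : (f (1, 0) * p.1 + f (0, 1) * p.2) / c ≤ 1 := by
    calc (f (1, 0) * p.1 + f (0, 1) * p.2) / c
        = p.1 * (f (1, 0) / c) + p.2 * (f (0, 1) / c) := by ring
      _ ≤ 1 := this
  rw [div_le_one hc0] at h'
  linarith

/-- The mean equals $(1+st)/((1-s^2)(1-t^2))$. It shows that moving the polar off centre does not
reduce the triangle bound when opposite sectors are added. -/
theorem one_le_half_add_inv_mul_inv {s t : ℝ} (hs : |s| < 1) (ht : |t| < 1) :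
    1 ≤ ((1 + s)⁻¹ * (1 + t)⁻¹ + (1 - s)⁻¹ * (1 - t)⁻¹) / 2 := by
  obtain ⟨s1, s2⟩ := abs_lt.1 hs
  obtain ⟨t1, t2⟩ := abs_lt.1 ht
  have p1 : 0 < 1 + s := by linarith
  have p2 : 0 < 1 - s := by linarith
  have p3 : 0 < 1 + t := by linarith
  have p4 : 0 < 1 - t := by linarith
  have e : ((1 + s)⁻¹ * (1 + t)⁻¹ + (1 - s)⁻¹ * (1 - t)⁻¹) / 2
      = (1 + s * t) / ((1 + s) * (1 - s) * ((1 + t) * (1 - t))) := by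
    field_simp; ring
  rw [e, one_le_div (by positivity)]
  have h1 : 0 ≤ s ^ 2 * ((1 + t) * (1 - t)) := by positivity
  have h2 : 0 ≤ t ^ 2 * ((1 + s) * (1 - s)) := by positivity
  nlinarith [sq_nonneg (s + t)]

/-- The linear map sending the standard basis to `u`, `v`. -/
def comb (u v : Plane) (p : ℝ × ℝ) : Plane := p.1 • u + p.2 • v

theorem cross_comb (u v : Plane) (p q : ℝ × ℝ) :
    cross (comb u v p) (comb u v q) = (p.1 * q.2 - p.2 * q.1) * cross u v := by
  simp [cross, comb]; ring

theorem comb_ne_zero {u v : Plane} (h : cross u v ≠ 0) {p : ℝ × ℝ} (hp : p ≠ 0) :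
    comb u v p ≠ 0 := by
  intro h0
  have h1 := cross_comb u v p (0, 1)
  have h2 := cross_comb u v (1, 0) p
  simp [h0, cross] at h1 h2
  exact hp (Prod.ext (h1.resolve_right h) (h2.resolve_right h))

@[simp] theorem comb_one_zero (u v : Plane) : comb u v (1, 0) = u := by simp [comb]

@[simp] theorem comb_zero_one (u v : Plane) : comb u v (0, 1) = v := by simp [comb]

@[simp] theorem comb_neg_one_zero (u v : Plane) : comb u v (-1, 0) = -u := by simp [comb]

/-- The first vector of the dual basis of `u`, `v`; the second one is `-dualVec v u`. -/
noncomputable def dualVec (u v : Plane) : Plane := (cross u v)⁻¹ • !₂[v 1, -v 0]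

theorem inner_dualVec (u v z : Plane) : inner ℝ (dualVec u v) z = (cross u v)⁻¹ * cross z v := by
  rw [inner_eq]
  simp [dualVec, cross]; ring

theorem inner_comb_dual {u v : Plane} (h : cross u v ≠ 0) (p q : ℝ × ℝ) :
    inner ℝ (comb (dualVec u v) (dualVec v u) p) (comb u v q) = p.1 * q.1 + p.2 * q.2 := by
  have h' : cross v u ≠ 0 := by rw [cross_swap]; simpa
  simp only [comb, inner_add_left, inner_add_right, inner_smul_left, inner_smul_right,
    inner_dualVec, cross_self, RCLike.conj_to_real]
  field_simp; ring

theorem cross_dualVec {u v : Plane} (h : cross u v ≠ 0) :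
    cross (dualVec u v) (dualVec v u) = (cross u v)⁻¹ := by
  have e : cross (dualVec u v) (dualVec v u) = (cross u v)⁻¹ * (cross v u)⁻¹ * cross v u := by
    simp [cross, dualVec]; ring
  have h' : cross v u ≠ 0 := by rw [cross_swap]; simpa
  rw [e, inv_mul_cancel_right₀ h']

/-- Replacing one of $u,v$ by another point of $C$ cannot increase the area, so coordinates of
points of $C$ in this basis are at most $1$. -/
theorem exists_cross_isMax {C : Set Plane} (hC : IsCompact C) {η : ℝ} (hη : 0 < η)
    (hball : Metric.ball (0 : Plane) η ⊆ C) :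
    ∃ u ∈ C, ∃ v ∈ C, 0 < cross u v ∧ ∀ z ∈ C, ∀ w ∈ C, cross z w ≤ cross u v := by
  have hmem : ∀ i, EuclideanSpace.single i (η / 2) ∈ C := fun i => by
    apply hball
    rw [mem_ball_zero_iff, PiLp.norm_single, Real.norm_of_nonneg (by positivity)]
    linarith
  obtain ⟨⟨u, v⟩, ⟨hu, hv⟩, hmax⟩ := (hC.prod hC).exists_isMaxOn ⟨_, mk_mem_prod (hmem 0) (hmem 0)⟩
    (f := fun p : Plane × Plane => cross p.1 p.2) (by unfold cross; fun_prop)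
  refine ⟨u, hu, v, hv, ?_, fun z hz w hw => hmax (mk_mem_prod hz hw)⟩
  have h : cross _ _ ≤ cross u v := hmax (mk_mem_prod (hmem 0) (hmem 1))
  refine lt_of_lt_of_le ?_ h
  simp [cross]
  positivity

theorem isSectorArea_comb {C : Set Plane} (hC : Convex ℝ C) (h0 : (0 : Plane) ∈ C)
    (hfin : volume C ≠ ⊤) (hsymm : ∀ z ∈ C, -z ∈ C) {u v : Plane} (h : 0 < cross u v) :
    IsSectorArea (comb u v ⁻¹' C)
      (fun p q => sectorArea C (comb u v p) (comb u v q) / cross u v) where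
  wedge_le p hp q hq := by
    rw [le_div_iff₀ h, ← cross_comb]
    have := cross_le_sectorArea hC h0 hfin one_pos one_pos one_pos one_pos (u := comb u v p)
      (v := comb u v q) (by rwa [one_smul]) (by rwa [one_smul]) (by rw [one_smul]; exact hsymm _ hp)
      (by rw [one_smul]; exact hsymm _ hq)
    norm_num at this
    exact (le_abs_self _).trans this
  add_le p q r hq h1 h2 h3 := by
    rw [← add_div]
    gcongr
    apply sectorArea_add_le hfin (comb_ne_zero h.ne' hq)
    all_goals rw [cross_comb]; positivity

/-- The set $L$ supplies the points and $D$ the area. A point of $L$ need not belong to $D$, but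
rescaled copies of it in both directions do, and their triangles in opposite sectors make up for the
rescaling. -/
theorem isSectorArea_comb_of_scaled {L D : Set Plane} (hD : Convex ℝ D) (h0 : (0 : Plane) ∈ D)
    (hfin : volume D ≠ ⊤)
    (hL : ∀ y ∈ L, ∃ s : ℝ, |s| < 1 ∧ (1 + s)⁻¹ • y ∈ D ∧ -((1 - s)⁻¹ • y) ∈ D)
    {u v : Plane} (h : 0 < cross u v) :
    IsSectorArea (comb u v ⁻¹' L)
      (fun p q => sectorArea D (comb u v p) (comb u v q) / cross u v) where
  wedge_le p hp q hq := by
    rw [le_div_iff₀ h, ← cross_comb]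
    obtain ⟨s, hs, s1, s2⟩ := hL _ hp
    obtain ⟨t, ht, t1, t2⟩ := hL _ hq
    obtain ⟨hs1, hs2⟩ := abs_lt.1 hs
    obtain ⟨ht1, ht2⟩ := abs_lt.1 ht
    have := cross_le_sectorArea hD h0 hfin (inv_pos.2 (by linarith)) (inv_pos.2 (by linarith))
      (inv_pos.2 (by linarith)) (inv_pos.2 (by linarith)) s1 t1 s2 t2
    refine le_trans ?_ this
    calc _ ≤ |cross (comb u v p) (comb u v q)| := le_abs_self _
      _ = 1 * |cross (comb u v p) (comb u v q)| := (one_mul _).symm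
      _ ≤ _ := by gcongr; exact one_le_half_add_inv_mul_inv hs ht
  add_le p q r hq h1 h2 h3 := by
    rw [← add_div]
    gcongr
    apply sectorArea_add_le hfin (comb_ne_zero h.ne' hq)
    all_goals rw [cross_comb]; positivity

theorem exists_parallelogram_of_volume_mul_le {C D : Set Plane} (hC : IsCompact C)
    (hconv : Convex ℝ C) (hsymm : ∀ z ∈ C, -z ∈ C) {η : ℝ} (hη : 0 < η)
    (hball : Metric.ball (0 : Plane) η ⊆ C) (hD : Convex ℝ D) (hD0 : (0 : Plane) ∈ D)
    (hDfin : volume D ≠ ⊤)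
    (hpol : ∀ y : Plane, (∀ z ∈ C, inner ℝ y z ≤ 1) →
      ∃ s : ℝ, |s| < 1 ∧ (1 + s)⁻¹ • y ∈ D ∧ -((1 - s)⁻¹ • y) ∈ D)
    {ε : ℝ} (hε : 0 < ε) (hvol : volume.real C * volume.real D ≤ 8 * (1 + ε)) :
    ∃ u v : Plane, cross u v ≠ 0 ∧ (∀ a b : ℝ, |a| ≤ 1 → |b| ≤ 1 → a • u + b • v ∈ C) ∧
      ∀ z ∈ C, ∃ a b : ℝ, |a| ≤ 1 + 200 * ε ∧ |b| ≤ 1 + 200 * ε ∧ z = a • u + b • v := by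
  obtain ⟨u, hu, v, hv, huv, hmax⟩ := exists_cross_isMax hC hη hball
  have hC0 : (0 : Plane) ∈ C := hball (Metric.mem_ball_self hη)
  have hCfin : volume C ≠ ⊤ := hC.measure_lt_top.ne
  set d := cross u v with hd
  set u' := dualVec u v
  set v' := dualVec v u
  have huv' : cross u' v' = d⁻¹ := cross_dualVec huv.ne'
  have hcoord : ∀ z, z = comb u v (cross z v / d, cross u z / d) :=
    fun z => exists_eq_smul_add_smul huv.ne' z
  set K : Set (ℝ × ℝ) := comb u v ⁻¹' C with hKdef
  set L : Set (ℝ × ℝ) := comb u' v' ⁻¹' {y | ∀ z ∈ C, inner ℝ y z ≤ 1} with hLdef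
  have memL : ∀ n : ℝ × ℝ, n ∈ L ↔ ∀ z ∈ K, n.1 * z.1 + n.2 * z.2 ≤ 1 := by
    intro n
    constructor
    · intro h z hz
      rw [← inner_comb_dual huv.ne']
      exact h _ hz
    · intro h z hz
      rw [hcoord z, inner_comb_dual huv.ne']
      refine h _ ?_
      rw [hKdef, mem_preimage, ← hcoord]
      exact hz
  have hKcont : Continuous (comb u v) := by unfold comb; fun_prop
  have hKc : IsCompact K := by
    have hcont : Continuous fun z => (cross z v / d, cross u z / d) := by unfold cross; fun_prop
    convert hC.image hcont using 1
    ext p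
    constructor
    · intro hp
      refine ⟨_, hp, ?_⟩
      simp only [comb, cross_smul_add_left, cross_smul_add_right, cross_self, ← hd]
      ext <;> field_simp <;> simp
    · rintro ⟨z, hz, rfl⟩
      rw [hKdef, mem_preimage, ← hcoord]
      exact hz
  have hKs : ∀ z ∈ K, -z ∈ K := by
    intro z hz
    have := hsymm _ hz
    rw [hKdef, mem_preimage]
    convert this using 1
    simp only [comb, Prod.fst_neg, Prod.snd_neg]; module
  have hLs : ∀ z ∈ L, -z ∈ L := by
    intro n hn
    rw [memL] at hn ⊢
    intro z hz
    have := hn _ (hKs z hz)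
    simp only [Prod.fst_neg, Prod.snd_neg] at this ⊢
    linarith
  have hKbox : ∀ z ∈ K, z.1 ≤ 1 ∧ z.2 ≤ 1 := by
    intro z hz
    have h1 := hmax _ hz _ hv
    have h2 := hmax _ hu _ hz
    simp only [comb, cross_smul_add_left, cross_smul_add_right, cross_self, ← hd] at h1 h2
    constructor <;> nlinarith
  have hK₁ : ((1, 0) : ℝ × ℝ) ∈ K := by simpa [hKdef] using hu
  have hK₂ : ((0, 1) : ℝ × ℝ) ∈ K := by simpa [hKdef] using hv
  have hLbox : ∀ z ∈ L, z.1 ≤ 1 ∧ z.2 ≤ 1 := by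
    intro z hz
    rw [memL] at hz
    have h1 := hz _ hK₁
    have h2 := hz _ hK₂
    constructor <;> linarith
  have hL₁ : ((1, 0) : ℝ × ℝ) ∈ L := (memL _).2 fun z hz => by simpa using (hKbox z hz).1
  have hL₂ : ((0, 1) : ℝ × ℝ) ∈ L := (memL _).2 fun z hz => by simpa using (hKbox z hz).2
  have hKL : ∀ n : ℝ × ℝ, (∀ z ∈ K, n.1 * z.1 + n.2 * z.2 ≤ 1) → n ∈ L := fun n => (memL n).2
  have hKconv : Convex ℝ K := by
    intro p hp q hq s t hs ht hst
    have := hconv hp hq hs ht hst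
    rw [hKdef, mem_preimage]
    convert this using 1
    simp only [comb, Prod.fst_add, Prod.snd_add, Prod.smul_fst, Prod.smul_snd, smul_eq_mul]
    module
  have hLK : ∀ p : ℝ × ℝ, (∀ n ∈ L, p.1 * n.1 + p.2 * n.2 ≤ 1) → p ∈ K := fun p hp =>
    mem_of_mem_bipolar hKc.isClosed hKconv (by simpa [hKdef, comb] using hC0)
      fun n hn => hp n (hKL n hn)
  have hLc : IsCompact L := by
    refine (isCompact_Icc (a := ((-1, -1) : ℝ × ℝ)) (b := (1, 1))).of_isClosed_subset ?_ ?_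
    · have : L = ⋂ z ∈ K, {n : ℝ × ℝ | n.1 * z.1 + n.2 * z.2 ≤ 1} := by
        ext n; simp only [memL, mem_iInter, mem_ofPred_eq]
      rw [this]
      exact isClosed_biInter fun z _ => isClosed_le (by fun_prop) continuous_const
    · intro z hz
      have h1 := hLbox _ hz
      have h2 := hLbox _ (hLs _ hz)
      simp only [Prod.fst_neg, Prod.snd_neg] at h2
      exact ⟨⟨by simp only; linarith, by simp only; linarith⟩, ⟨h1.1, h1.2⟩⟩
  have hα := isSectorArea_comb hconv hC0 hCfin hsymm huv
  have hβ := isSectorArea_comb_of_scaled (u := u') (v := v') hD hD0 hDfin hpol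
    (by rw [huv']; positivity)
  have key := close_to_ball_of_sector_mul_le hKc hLc hKs hLs hKbox hLbox hK₁ hK₂ hL₁ hL₂ hKL hLK
    hα hβ hε (by
      simp only [comb_one_zero, comb_zero_one, comb_neg_one_zero]
      rw [← add_div, ← add_div, huv', ← hd, div_mul_div_comm, mul_inv_cancel₀ huv.ne', div_one]
      refine le_trans ?_ hvol
      refine mul_le_mul (sectorArea_add_le_volume hCfin huv)
        (sectorArea_add_le_volume hDfin (by rw [huv']; positivity)) ?_ measureReal_nonneg
      unfold sectorArea
      positivity)
  have abs_le : ∀ S : Set (ℝ × ℝ), (∀ z ∈ S, -z ∈ S) → (∀ z ∈ S, z.1 ≤ 1 ∧ z.2 ≤ 1) →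
      ∀ z ∈ S, |z.1| ≤ 1 ∧ |z.2| ≤ 1 := by
    intro S hs hb z hz
    have h1 := hb _ hz
    have h2 := hb _ (hs _ hz)
    simp only [Prod.fst_neg, Prod.snd_neg] at h2
    exact ⟨abs_le.2 ⟨by linarith, h1.1⟩, abs_le.2 ⟨by linarith, h1.2⟩⟩
  have memK : ∀ z ∈ C, ∃ p ∈ K, z = comb u v p := fun z hz =>
    ⟨_, by rw [hKdef, mem_preimage, ← hcoord]; exact hz, hcoord z⟩
  have inner_le : ∀ a b c e : ℝ, a * b + c * e ≤ |a| * |b| + |c| * |e| := by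
    intro a b c e
    rw [← abs_mul, ← abs_mul]
    exact add_le_add (le_abs_self _) (le_abs_self _)
  rcases key with h | h
  -- Here $C$ is near the $\ell^1$ ball, a parallelogram with half-edges $(u+v)/2$ and $(v-u)/2$. It
  -- lies in $C$ by the bipolar theorem because $L$ is in the $\ell^\infty$ ball.
  · refine ⟨(1 / 2 : ℝ) • u + (1 / 2 : ℝ) • v, (-1 / 2 : ℝ) • u + (1 / 2 : ℝ) • v, ?_, ?_, ?_⟩
    · have : cross ((1 / 2 : ℝ) • u + (1 / 2 : ℝ) • v) ((-1 / 2 : ℝ) • u + (1 / 2 : ℝ) • v)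
          = cross u v / 2 := by simp [cross]; ring
      rw [this, ← hd]
      positivity
    · intro a b ha hb
      have : ((a - b) / 2, (a + b) / 2) ∈ K := by
        refine hLK _ fun n hn => (inner_le _ _ _ _).trans ?_
        obtain ⟨n1, n2⟩ := abs_le L hLs hLbox n hn
        simp only
        have h1 : |(a - b) / 2| + |(a + b) / 2| ≤ 1 := by
          rw [abs_le'] at ha hb
          rcases abs_cases ((a - b) / 2) with ⟨e, _⟩ | ⟨e, _⟩ <;>
            rcases abs_cases ((a + b) / 2) with ⟨e', _⟩ | ⟨e', _⟩ <;> rw [e, e'] <;> linarith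
        have h2 := mul_le_mul_of_nonneg_left n1 (abs_nonneg ((a - b) / 2))
        have h3 := mul_le_mul_of_nonneg_left n2 (abs_nonneg ((a + b) / 2))
        linarith
      rw [hKdef, mem_preimage] at this
      convert this using 1
      simp only [comb]; module
    · intro z hz
      obtain ⟨p, hp, rfl⟩ := memK z hz
      have hp' := h p hp
      refine ⟨p.1 + p.2, p.2 - p.1, (abs_add_le _ _).trans hp', ?_, ?_⟩
      · exact (abs_sub _ _).trans (by linarith)
      · simp only [comb]; module
  -- Here $L$ is near the $\ell^1$ ball; dually $C$ contains the $\ell^\infty$ ball shrunk by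
  -- $1+200\varepsilon$.
  · have hl : 0 < 1 + 200 * ε := by positivity
    refine ⟨(1 + 200 * ε)⁻¹ • u, (1 + 200 * ε)⁻¹ • v, ?_, ?_, ?_⟩
    · rw [cross_smul_smul]; positivity
    · intro a b ha hb
      have : (a * (1 + 200 * ε)⁻¹, b * (1 + 200 * ε)⁻¹) ∈ K := by
        refine hLK _ fun n hn => ?_
        have h1 := inner_le a n.1 b n.2
        have h2 := mul_le_mul_of_nonneg_right ha (abs_nonneg n.1)
        have h3 := mul_le_mul_of_nonneg_right hb (abs_nonneg n.2)
        have h4 := h n hn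
        calc a * (1 + 200 * ε)⁻¹ * n.1 + b * (1 + 200 * ε)⁻¹ * n.2
            = (a * n.1 + b * n.2) / (1 + 200 * ε) := by ring
          _ ≤ 1 := (div_le_one hl).2 (by linarith)
      rw [hKdef, mem_preimage] at this
      convert this using 1
      simp only [comb]; module
    · intro z hz
      obtain ⟨p, hp, rfl⟩ := memK z hz
      obtain ⟨h1, h2⟩ := abs_le K hKs hKbox p hp
      refine ⟨(1 + 200 * ε) * p.1, (1 + 200 * ε) * p.2, ?_, ?_, ?_⟩
      · rw [abs_mul, abs_of_pos hl]; nlinarith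
      · rw [abs_mul, abs_of_pos hl]; nlinarith
      · simp only [comb, smul_smul]
        rw [mul_right_comm, mul_inv_cancel₀ hl.ne', mul_right_comm, mul_inv_cancel₀ hl.ne',
          one_mul, one_mul]

/-! ### Polars about a point other than the centre. -/

theorem IsCentre.neg_add_mem {S : Set Plane} {k z : Plane} (h : IsCentre k S) (hz : k + z ∈ S) :
    k + -z ∈ S := by
  have : Equiv.pointReflection k (k + z) ∈ S := h.subset (mem_image_of_mem _ hz)
  rw [Equiv.pointReflection_apply] at this
  convert this using 1
  simp only [vsub_eq_sub, vadd_eq_add]; abel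

theorem convex_polarSet (K : Set Plane) : Convex ℝ (polarSet K) := by
  intro x hx y hy a b ha hb hab z hz
  rw [inner_add_left, inner_smul_left, inner_smul_left]
  simp only [RCLike.conj_to_real]
  have h1 := mul_le_mul_of_nonneg_left (hx z hz) ha
  have h2 := mul_le_mul_of_nonneg_left (hy z hz) hb
  linarith

theorem zero_mem_polarSet (K : Set Plane) : (0 : Plane) ∈ polarSet K := fun y _ => by simp

/-- Take $s=\langle y,k\rangle$. From $\langle y,x-k\rangle\le1$ and its reflection, $\langle
y,x\rangle\le1+s$ and $-\langle y,x\rangle\le1-s$ on $K$. The origin being interior, $K$ contains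
$-\delta k$ for some $\delta>0$, which makes $|s|<1$ strict. -/
theorem exists_scaled_mem_polarSet {K : Set Plane} {k : Plane}
    (hsymm : ∀ z, k + z ∈ K → k + -z ∈ K) {η : ℝ} (hη : 0 < η)
    (hball : Metric.ball (0 : Plane) η ⊆ K) {y : Plane} (hy : ∀ z, k + z ∈ K → inner ℝ y z ≤ 1) :
    ∃ s : ℝ, |s| < 1 ∧ (1 + s)⁻¹ • y ∈ polarSet K ∧ -((1 - s)⁻¹ • y) ∈ polarSet K := by
  obtain ⟨δ, hδ, hδK⟩ : ∃ δ : ℝ, 0 < δ ∧ -(δ • k) ∈ K := by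
    refine ⟨η / (2 * (‖k‖ + 1)), by positivity, hball ?_⟩
    rw [mem_ball_zero_iff, norm_neg, norm_smul, Real.norm_of_nonneg (by positivity),
      div_mul_eq_mul_div, div_lt_iff₀ (by positivity)]
    nlinarith [norm_nonneg k]
  have h1 := hy (-((1 + δ) • k)) (by convert hδK using 1; module)
  have h2 := hy (- -((1 + δ) • k)) (hsymm _ (by convert hδK using 1; module))
  simp only [neg_neg, inner_neg_right, inner_smul_right] at h1 h2
  have hs : |inner ℝ y k| < 1 := by
    rw [abs_lt]
    constructor <;> by_contra hcon <;> push Not at hcon <;> nlinarith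
  obtain ⟨hs1, hs2⟩ := abs_lt.1 hs
  refine ⟨inner ℝ y k, hs, fun x hx => ?_, fun x hx => ?_⟩
  · have := hy (x - k) (by simpa using hx)
    rw [inner_sub_right] at this
    rw [inner_smul_left, RCLike.conj_to_real, inv_mul_le_iff₀ (by linarith)]
    linarith
  · have := hy (-(x - k)) (hsymm _ (by simpa using hx))
    rw [inner_neg_right, inner_sub_right] at this
    rw [inner_neg_left, inner_smul_left, RCLike.conj_to_real, ← mul_neg,
      inv_mul_le_iff₀ (by linarith)]
    linarith

theorem volume_real_mul_le (K : ConvexBody Plane) (h0 : (0 : Plane) ∈ interior (K : Set Plane))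
    {ε : ℝ} (hε : 0 < ε)
    (hvol : volume (K : Set Plane) * volume (polarSet (K : Set Plane)) ≤
      ENNReal.ofReal ((1 + ε) * 8)) :
    volume (polarSet (K : Set Plane)) ≠ ⊤ ∧
      volume.real (K : Set Plane) * volume.real (polarSet (K : Set Plane)) ≤ 8 * (1 + ε) := by
  have hpos : volume (K : Set Plane) ≠ 0 :=
    (Measure.measure_pos_of_mem_nhds volume (mem_interior_iff_mem_nhds.1 h0)).ne'
  constructor
  · intro h
    rw [h, ENNReal.mul_top hpos] at hvol
    exact absurd (hvol.trans_lt ENNReal.ofReal_lt_top) (lt_irrefl _)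
  · have := ENNReal.toReal_mono ENNReal.ofReal_ne_top hvol
    rw [ENNReal.toReal_mul, ENNReal.toReal_ofReal (by positivity)] at this
    simp only [Measure.real]
    linarith

theorem exists_parallelogram_between (K : ConvexBody Plane) {k : Plane}
    (hk : IsCentre k (K : Set Plane)) (h0 : (0 : Plane) ∈ interior (K : Set Plane)) {ε : ℝ}
    (hε : 0 < ε)
    (hvol : volume (K : Set Plane) * volume (polarSet (K : Set Plane)) ≤
      ENNReal.ofReal ((1 + ε) * 8)) :
    ∃ u v : Plane, cross u v ≠ 0 ∧
      (∀ a b : ℝ, |a| ≤ 1 → |b| ≤ 1 → k + (a • u + b • v) ∈ (K : Set Plane)) ∧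
      ∀ z ∈ (K : Set Plane), ∃ a b : ℝ, |a| ≤ 1 + 200 * ε ∧ |b| ≤ 1 + 200 * ε ∧
        z = k + (a • u + b • v) := by
  obtain ⟨hDfin, hvol'⟩ := volume_real_mul_le K h0 hε hvol
  obtain ⟨η, hη, hball⟩ := Metric.mem_nhds_iff.1 (mem_interior_iff_mem_nhds.1 h0)
  have hsymm : ∀ z, k + z ∈ (K : Set Plane) → k + -z ∈ (K : Set Plane) :=
    fun z hz => hk.neg_add_mem hz
  set C : Set Plane := (fun z => k + z) ⁻¹' (K : Set Plane) with hC
  have hCvol : volume.real C = volume.real (K : Set Plane) := by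
    simp only [Measure.real, hC, measure_preimage_add]
  have hCconv : Convex ℝ C := K.convex.translate_preimage_right k
  obtain ⟨u, v, huv, h1, h2⟩ := exists_parallelogram_of_volume_mul_le (C := C)
    ((Homeomorph.addLeft k).isCompact_preimage.2 K.isCompact) hCconv hsymm hη (fun x hx => by
      -- A point $x$ near $o$ is the midpoint of $x-k$ and $x+k$, both in $C$ by its symmetry.
      have a1 : x - k ∈ C := by simpa [hC] using hball hx
      have a2 : -x - k ∈ C := by
        have : -x ∈ (K : Set Plane) := hball (by simpa using hx)
        simpa [hC] using this
      have := hCconv a1 (hsymm _ a2) (by norm_num : (0 : ℝ) ≤ 1 / 2)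
        (by norm_num : (0 : ℝ) ≤ 1 / 2) (by norm_num)
      convert this using 1
      module)
    (convex_polarSet K) (zero_mem_polarSet K) hDfin
    (fun y hy => exists_scaled_mem_polarSet hsymm hη hball hy) hε
    (by rwa [hCvol])
  refine ⟨u, v, huv, h1, fun z hz => ?_⟩
  obtain ⟨a, b, ha, hb, hab⟩ := h2 (z - k) (by simpa [hC] using hz)
  exact ⟨a, b, ha, hb, by rw [← hab]; abel⟩

/-! ### Parallelograms and the Banach–Mazur distance. -/

theorem cross_ne_zero_of_linearIndependent {v : Fin 2 → Plane} (h : LinearIndependent ℝ v) :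
    cross (v 0) (v 1) ≠ 0 := by
  intro h0
  have key : ∀ z, cross z (v 1) = 0 := fun z => by
    have e := cross_smul_eq (v 0) (v 1) z
    rw [h0, zero_smul] at e
    exact Fintype.linearIndependent_iff.1 h ![cross z (v 1), cross (v 0) z]
      (by simpa [Fin.sum_univ_two] using e.symm) 0
  have a := key (!₂[1, 0])
  have b := key (!₂[0, 1])
  simp [cross] at a b
  refine h.ne_zero 1 ?_
  ext i
  fin_cases i <;> simp [a, b]

theorem linearIndependent_of_cross_ne_zero {u v : Plane} (h : cross u v ≠ 0) :
    LinearIndependent ℝ ![u, v] := by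
  rw [LinearIndependent.pair_iff]
  intro s t hst
  have h1 := congrArg (fun z => cross z v) hst
  have h2 := congrArg (fun z => cross u z) hst
  simp only [cross_smul_add_left, cross_smul_add_right, cross_self] at h1 h2
  simp [cross] at h1 h2
  exact ⟨h1.resolve_right h, h2.resolve_right h⟩

theorem coords_unique {u v : Plane} (h : cross u v ≠ 0) {a b a' b' : ℝ}
    (he : a • u + b • v = a' • u + b' • v) : a = a' ∧ b = b' := by
  have h1 := congrArg (fun z => cross z v) he
  have h2 := congrArg (fun z => cross u z) he
  simp only [cross_smul_add_left, cross_smul_add_right, cross_self, mul_zero, add_zero,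
    zero_add] at h1 h2
  exact ⟨mul_right_cancel₀ h h1, mul_right_cancel₀ h h2⟩

theorem mem_vadd_parallelepiped {p z : Plane} {v : Fin 2 → Plane} :
    z ∈ p +ᵥ parallelepiped v ↔ ∃ a b : ℝ, |a| ≤ 1 / 2 ∧ |b| ≤ 1 / 2 ∧
      z = (p + (1 / 2 : ℝ) • (v 0 + v 1)) + (a • v 0 + b • v 1) := by
  simp only [mem_vadd_set, mem_parallelepiped_iff, Fin.sum_univ_two, vadd_eq_add]
  constructor
  · rintro ⟨_, ⟨t, ⟨h0, h1⟩, rfl⟩, rfl⟩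
    have p0 := h0 0; have p1 := h0 1; have q0 := h1 0; have q1 := h1 1
    simp only [Pi.zero_apply, Pi.one_apply] at p0 p1 q0 q1
    refine ⟨t 0 - 1 / 2, t 1 - 1 / 2, abs_le.2 ⟨by linarith, by linarith⟩,
      abs_le.2 ⟨by linarith, by linarith⟩, ?_⟩
    module
  · rintro ⟨a, b, ha, hb, rfl⟩
    rw [abs_le] at ha hb
    refine ⟨_, ⟨![a + 1 / 2, b + 1 / 2], ⟨?_, ?_⟩, rfl⟩, ?_⟩
    · intro i; fin_cases i <;> simp <;> linarith
    · intro i; fin_cases i <;> simp <;> linarith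
    · simp only [Matrix.cons_val_zero, Matrix.cons_val_one]
      module

theorem banachMazurDist_le_of_between {K P : Set Plane} {k u v : Plane} {l : ℝ} (hl : 0 < l)
    (huv : cross u v ≠ 0)
    (hin : ∀ a b : ℝ, |a| ≤ 1 → |b| ≤ 1 → k + (a • u + b • v) ∈ K)
    (hout : ∀ z ∈ K, ∃ a b : ℝ, |a| ≤ l ∧ |b| ≤ l ∧ z = k + (a • u + b • v))
    (hP : IsParallelogram P) : banachMazurDist K P ≤ l := by
  obtain ⟨p, w, hw, rfl⟩ := hP
  refine csInf_le (bddBelow_banachMazurRatios K _) ?_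
  have hcard : Fintype.card (Fin 2) = Module.finrank ℝ Plane := by simp
  set bu := basisOfLinearIndependentOfCardEqFinrank (linearIndependent_of_cross_ne_zero huv) hcard
    with hbu
  set bw := basisOfLinearIndependentOfCardEqFinrank hw hcard with hbw
  have hl2 : (2 * l)⁻¹ ≠ 0 := by positivity
  -- The scale $1/(2l)$ makes $A$ carry the outer parallelogram, with half-edges $lu,lv$, exactly
  -- onto $P$. Then $l\cdot A$ carries the inner one onto a translate of $P$, and $c-lc$ corrects
  -- the translation.
  set T : Plane ≃ₗ[ℝ] Plane :=
    (bu.equiv bw (Equiv.refl _)).trans (LinearEquiv.smulOfNeZero ℝ Plane _ hl2) with hT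
  have hT0 : T u = (2 * l)⁻¹ • w 0 := by
    have : bu 0 = u := by simp [hbu]
    rw [← this]
    simp [hT, hbw, Module.Basis.equiv_apply]
  have hT1 : T v = (2 * l)⁻¹ • w 1 := by
    have : bu 1 = v := by simp [hbu]
    rw [← this]
    simp [hT, hbw, Module.Basis.equiv_apply]
  set c := p + (1 / 2 : ℝ) • (w 0 + w 1) with hc
  set A : Plane ≃ᵃ[ℝ] Plane := (AffineEquiv.constVAdd ℝ Plane (-k)).trans
    (T.toAffineEquiv.trans (AffineEquiv.constVAdd ℝ Plane c)) with hAdef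
  have hA : ∀ a b : ℝ, A (k + (a • u + b • v)) = c + ((a / (2 * l)) • w 0 + (b / (2 * l)) • w 1) := by
    intro a b
    simp only [hAdef, AffineEquiv.trans_apply, AffineEquiv.constVAdd_apply, vadd_eq_add,
      LinearEquiv.coe_toAffineEquiv, neg_add_cancel_left, map_add, map_smul, hT0, hT1, smul_smul,
      div_eq_mul_inv]
  refine ⟨1, l, A, c - l • c, one_pos, hl, ?_, ?_, by rw [div_one]⟩
  · rintro _ ⟨_, ⟨z, hz, rfl⟩, rfl⟩
    obtain ⟨a, b, ha, hb, rfl⟩ := hout z hz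
    refine mem_vadd_parallelepiped.2 ⟨a / (2 * l), b / (2 * l), ?_, ?_, ?_⟩
    · rw [abs_div, abs_of_pos (by positivity : 0 < 2 * l), div_le_iff₀ (by positivity)]; linarith
    · rw [abs_div, abs_of_pos (by positivity : 0 < 2 * l), div_le_iff₀ (by positivity)]; linarith
    · simp only [one_smul]
      exact hA a b
  · intro y hy
    obtain ⟨a, b, ha, hb, rfl⟩ := mem_vadd_parallelepiped.1 hy
    refine ⟨l • A (k + ((2 * a) • u + (2 * b) • v)), ⟨_, ⟨_, hin _ _ ?_ ?_, rfl⟩, rfl⟩, ?_⟩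
    · rw [abs_mul, abs_two]; linarith
    · rw [abs_mul, abs_two]; linarith
    · simp only [hA, vadd_eq_add, ← hc]
      rw [mul_div_mul_left _ _ two_ne_zero, mul_div_mul_left _ _ two_ne_zero, smul_add l c,
        smul_add l (_ • _), smul_smul, smul_smul, mul_div_cancel₀ _ hl.ne',
        mul_div_cancel₀ _ hl.ne', ← add_assoc, sub_add_cancel]

/-! ### Location of the centre. -/

/-- The volume product of a body between a parallelogram and a bigger one, with the polar taken with
respect to a point with relative coordinates `-s`, `-t` in the bigger one. -/
theorem sq_mul_inv_add_inv_le {K : Set Plane} {u v : Plane} (huv : 0 < cross u v)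
    (hKfin : volume K ≠ ⊤) (hDfin : volume (polarSet K) ≠ ⊤) {q : Plane} {r s t h : ℝ} (hr : 0 < r)
    (hin : ∀ a b : ℝ, |a| ≤ 1 / 2 → |b| ≤ 1 / 2 → q + (a • (r • u) + b • (r • v)) ∈ K)
    (hout : ∀ z ∈ K, ∃ a b : ℝ, |a - s| ≤ h ∧ |b - t| ≤ h ∧ z = a • u + b • v)
    (hs : |s| < h) (ht : |t| < h) {V : ℝ} (hvol : volume.real K * volume.real (polarSet K) ≤ V) :
    r ^ 2 * (((h + s)⁻¹ + (h - s)⁻¹) * ((h + t)⁻¹ + (h - t)⁻¹) / 2) ≤ V := by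
  have hvu : cross v u ≠ 0 := by rw [cross_swap]; simpa using huv.ne'
  have hKvol : r ^ 2 * cross u v ≤ volume.real K := by
    have hsub : (q - (1 / 2 : ℝ) • (r • u + r • v)) +ᵥ parallelepiped ![r • u, r • v] ⊆ K := by
      intro z hz
      obtain ⟨a, b, ha, hb, rfl⟩ := mem_vadd_parallelepiped.1 hz
      have := hin a b ha hb
      simpa using this
    have := measureReal_mono hsub hKfin
    rw [measureReal_def, measure_vadd, volume_parallelepiped_pair,
      ENNReal.toReal_ofReal (abs_nonneg _), cross_smul_smul, ← pow_two,
      abs_of_pos (by positivity)] at this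
    exact this
  obtain ⟨hs1, hs2⟩ := abs_lt.1 hs
  obtain ⟨ht1, ht2⟩ := abs_lt.1 ht
  have i1 : 0 < h + s := by linarith
  have i2 : 0 < h - s := by linarith
  have i3 : 0 < h + t := by linarith
  have i4 : 0 < h - t := by linarith
  have inner_u : ∀ a b : ℝ, inner ℝ (dualVec u v) (a • u + b • v) = a := fun a b => by
    rw [inner_dualVec, cross_smul_add_left, cross_self, mul_zero, add_zero, mul_comm,
      mul_inv_cancel_right₀ huv.ne']
  have inner_v : ∀ a b : ℝ, inner ℝ (dualVec v u) (a • u + b • v) = b := fun a b => by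
    rw [inner_dualVec, cross_smul_add_left, cross_self, mul_zero, zero_add, mul_comm,
      mul_inv_cancel_right₀ hvu]
  have m1 : (h + s)⁻¹ • dualVec u v ∈ polarSet K := fun z hz => by
    obtain ⟨a, b, ha, hb, rfl⟩ := hout z hz
    rw [inner_smul_left, inner_u, RCLike.conj_to_real, inv_mul_le_iff₀ i1]
    linarith [(abs_le.1 ha).2]
  have m2 : -((h - s)⁻¹ • dualVec u v) ∈ polarSet K := fun z hz => by
    obtain ⟨a, b, ha, hb, rfl⟩ := hout z hz
    rw [inner_neg_left, inner_smul_left, inner_u, RCLike.conj_to_real, ← mul_neg,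
      inv_mul_le_iff₀ i2]
    linarith [(abs_le.1 ha).1]
  have m3 : (h + t)⁻¹ • dualVec v u ∈ polarSet K := fun z hz => by
    obtain ⟨a, b, ha, hb, rfl⟩ := hout z hz
    rw [inner_smul_left, inner_v, RCLike.conj_to_real, inv_mul_le_iff₀ i3]
    linarith [(abs_le.1 hb).2]
  have m4 : -((h - t)⁻¹ • dualVec v u) ∈ polarSet K := fun z hz => by
    obtain ⟨a, b, ha, hb, rfl⟩ := hout z hz
    rw [inner_neg_left, inner_smul_left, inner_v, RCLike.conj_to_real, ← mul_neg,
      inv_mul_le_iff₀ i4]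
    linarith [(abs_le.1 hb).1]
  have hD := convex_polarSet K
  have hD0 := zero_mem_polarSet K
  have hc := cross_dualVec huv.ne'
  have hcpos : 0 < cross (dualVec u v) (dualVec v u) := by rw [hc]; positivity
  -- The four points of `m1`–`m4` are the vertices of the polar of the outer parallelogram; the two
  -- opposite pairs of triangles at $o$ give its area.
  have s1 := cross_le_sectorArea hD hD0 hDfin (inv_pos.2 i1) (inv_pos.2 i3) (inv_pos.2 i2)
    (inv_pos.2 i4) m1 m3 m2 m4
  have s2 := cross_le_sectorArea hD hD0 hDfin (u := dualVec v u) (v := -dualVec u v)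
    (inv_pos.2 i3) (inv_pos.2 i2) (inv_pos.2 i4) (inv_pos.2 i1) m3 (by rwa [smul_neg]) m4
    (by rwa [smul_neg, neg_neg])
  rw [cross_neg_right, cross_swap, neg_neg, abs_of_pos hcpos, hc] at s2
  rw [abs_of_pos hcpos, hc] at s1
  have hDvol := sectorArea_add_le_volume hDfin hcpos
  have hDvol' : ((h + s)⁻¹ + (h - s)⁻¹) * ((h + t)⁻¹ + (h - t)⁻¹) / 2 * (cross u v)⁻¹ ≤
      volume.real (polarSet K) := by linarith
  refine le_trans ?_ hvol
  calc r ^ 2 * (((h + s)⁻¹ + (h - s)⁻¹) * ((h + t)⁻¹ + (h - t)⁻¹) / 2)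
      = (r ^ 2 * cross u v) *
        (((h + s)⁻¹ + (h - s)⁻¹) * ((h + t)⁻¹ + (h - t)⁻¹) / 2 * (cross u v)⁻¹) := by
        field_simp
    _ ≤ _ := mul_le_mul hKvol hDvol' (by positivity) measureReal_nonneg

/-- The factor in $t$ is smallest at $t=0$, which leaves
$4(1+\varepsilon)s^2\le(1+\varepsilon)R^2-r^2\le604\varepsilon$. The constant $169=13^2$ is a
rounding up convenient for the square root. -/
theorem sq_le_of_inv_add_inv_le {r R s t ε : ℝ} (hε : 0 < ε) (hε1 : 200 * ε < 1) (hr : 0 < r)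
    (hr1 : r ≤ 1) (hR : R ≤ (1 + 200 * ε) * r) (hs : |s| < R / 2) (ht : |t| < R / 2)
    (h : r ^ 2 * (((R / 2 + s)⁻¹ + (R / 2 - s)⁻¹) * ((R / 2 + t)⁻¹ + (R / 2 - t)⁻¹) / 2)
      ≤ 8 * (1 + ε)) : s ^ 2 ≤ 169 * ε := by
  obtain ⟨hs1, hs2⟩ := abs_lt.1 hs
  obtain ⟨ht1, ht2⟩ := abs_lt.1 ht
  have hR0 : 0 < R := by linarith [abs_nonneg s]
  have i1 : 0 < R / 2 + s := by linarith
  have i2 : 0 < R / 2 - s := by linarith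
  have i3 : 0 < R / 2 + t := by linarith
  have i4 : 0 < R / 2 - t := by linarith
  have e1 : (R / 2 + s)⁻¹ + (R / 2 - s)⁻¹ = R / ((R / 2 + s) * (R / 2 - s)) := by
    rw [inv_add_inv i1.ne' i2.ne']; ring
  have e2 : 4 / R ≤ (R / 2 + t)⁻¹ + (R / 2 - t)⁻¹ := by
    have : (R / 2 + t)⁻¹ + (R / 2 - t)⁻¹ = R / ((R / 2 + t) * (R / 2 - t)) := by
      rw [inv_add_inv i3.ne' i4.ne']; ring
    rw [this, div_le_div_iff₀ hR0 (by positivity)]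
    nlinarith [sq_nonneg t]
  have h2 : r ^ 2 * (R / ((R / 2 + s) * (R / 2 - s)) * (4 / R) / 2) ≤ 8 * (1 + ε) := by
    refine le_trans ?_ h
    rw [e1]
    gcongr
  have e3 : r ^ 2 * (R / ((R / 2 + s) * (R / 2 - s)) * (4 / R) / 2)
      = 2 * r ^ 2 / ((R / 2 + s) * (R / 2 - s)) := by
    field_simp; ring
  rw [e3, div_le_iff₀ (by positivity)] at h2
  have hRsq : R ^ 2 ≤ (1 + 200 * ε) ^ 2 * r ^ 2 := by
    rw [← mul_pow]; gcongr
  have hη : (1 + ε) * (1 + 200 * ε) ^ 2 ≤ 1 + 604 * ε := by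
    have q1 : 0 ≤ ε * (1 - 200 * ε) := mul_nonneg hε.le (by linarith)
    have q2 : 0 ≤ ε * ε * (1 - 200 * ε) := mul_nonneg (mul_self_nonneg ε) (by linarith)
    linarith
  have hrsq : r ^ 2 ≤ 1 := pow_le_one₀ hr.le hr1
  have a1 := mul_le_mul_of_nonneg_left hRsq (by linarith : 0 ≤ 1 + ε)
  have a2 := mul_le_mul_of_nonneg_right hη (sq_nonneg r)
  have a3 := mul_le_mul_of_nonneg_left hrsq (by linarith : 0 ≤ 604 * ε)
  have a4 : 0 ≤ ε * s ^ 2 := by positivity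
  linarith

/-- One coordinate of the nesting of two homothetic parallelograms, tested at two opposite corners.
It controls how far their centres are apart. -/
theorem abs_le_of_nested {r R g : ℝ} (h : |r * (g + 1 / 2) - R * g| ≤ R / 2)
    (h' : |r * (g - 1 / 2) - R * g| ≤ R / 2) : r ≤ R ∧ |(R - r) * g| ≤ (R - r) / 2 := by
  rw [abs_le] at *
  refine ⟨by linarith, by constructor <;> linarith⟩

/-- The offset of the outer centre is at most $13\sqrt\varepsilon$. Passing to the mean
parallelogram shifts it by $(R-1)g=(R-r)g/2$, at most $50\varepsilon\le4\sqrt\varepsilon$. -/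
theorem abs_sub_le_mul_sqrt {r R s g ε : ℝ} (hε : 0 < ε) (hε1 : 200 * ε < 1) (hr1 : r ≤ 1)
    (hsum : r + R = 2) (hR : R ≤ (1 + 200 * ε) * r) (hs : s ^ 2 ≤ 169 * ε)
    (hg : |(R - r) * g| ≤ (R - r) / 2) : |s - (R - 1) * g| ≤ 17 * √ε := by
  have hq : √ε ^ 2 = ε := Real.sq_sqrt hε.le
  have hs' : |s| ≤ 13 * √ε := by
    apply abs_le_of_sq_le_sq _ (by positivity)
    rw [mul_pow, hq]; linarith
  have hq1 : √ε ≤ 0.08 := by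
    rw [Real.sqrt_le_left (by norm_num)]; norm_num; linarith
  have h1 : (R - 1) * g = (R - r) * g / 2 := by
    obtain rfl : r = 2 - R := by linarith
    ring
  have h2 : |(R - 1) * g| ≤ 50 * ε := by
    rw [h1, abs_div, abs_two]
    have := mul_le_mul_of_nonneg_left hr1 (by linarith : 0 ≤ 200 * ε)
    linarith
  have h3 : 50 * ε ≤ 4 * √ε := by nlinarith [Real.sqrt_nonneg ε]
  exact (abs_sub _ _).trans (by linarith)

/-- Two homothetic parallelograms squeezing a body with almost minimal volume product have their
mean centred near the origin. -/
theorem exists_centre_coords (K : ConvexBody Plane)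
    (h0 : (0 : Plane) ∈ interior (K : Set Plane)) {ε : ℝ} (hε : 0 < ε) (hε1 : 200 * ε < 1)
    (hvol : volume (K : Set Plane) * volume (polarSet (K : Set Plane)) ≤
      ENNReal.ofReal ((1 + ε) * 8)) {x g u v : Plane} (huv : 0 < cross u v) {r R : ℝ} (hr : 0 < r)
    (hR0 : 0 < R) (hsum : r + R = 2) (hR : R ≤ (1 + 200 * ε) * r)
    (hin : ∀ a b : ℝ, |a| ≤ 1 / 2 → |b| ≤ 1 / 2 → x + r • (g + (a • u + b • v)) ∈ (K : Set Plane))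
    (hout : ∀ z ∈ (K : Set Plane), ∃ a b : ℝ, |a| ≤ 1 / 2 ∧ |b| ≤ 1 / 2 ∧
      z = x + R • (g + (a • u + b • v))) :
    ∃ a b : ℝ, |a| ≤ 17 * √ε ∧ |b| ≤ 17 * √ε ∧ x + g = a • u + b • v := by
  obtain ⟨hDfin, hvol'⟩ := volume_real_mul_le K h0 hε hvol
  have hx := exists_eq_smul_add_smul huv.ne' x
  have hg := exists_eq_smul_add_smul huv.ne' g
  set x₀ := cross x v / cross u v
  set x₁ := cross u x / cross u v
  set g₀ := cross g v / cross u v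
  set g₁ := cross u g / cross u v
  have hout' : ∀ z ∈ (K : Set Plane), ∃ a b : ℝ, |a - (x₀ + R * g₀)| ≤ R / 2 ∧
      |b - (x₁ + R * g₁)| ≤ R / 2 ∧ z = a • u + b • v := by
    intro z hz
    obtain ⟨a, b, ha, hb, rfl⟩ := hout z hz
    refine ⟨x₀ + R * g₀ + R * a, x₁ + R * g₁ + R * b, ?_, ?_, ?_⟩
    · rw [add_sub_cancel_left, abs_mul, abs_of_pos hR0]; nlinarith
    · rw [add_sub_cancel_left, abs_mul, abs_of_pos hR0]; nlinarith
    · conv_lhs => rw [hx, hg]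
      module
  have coord : ∀ a b : ℝ, a • u + b • v ∈ (K : Set Plane) →
      |a - (x₀ + R * g₀)| ≤ R / 2 ∧ |b - (x₁ + R * g₁)| ≤ R / 2 := by
    intro a b hab
    obtain ⟨a', b', ha, hb, he⟩ := hout' _ hab
    obtain ⟨rfl, rfl⟩ := coords_unique huv.ne' he
    exact ⟨ha, hb⟩
  have hin' : ∀ a b : ℝ, |a| ≤ 1 / 2 → |b| ≤ 1 / 2 →
      (x₀ + r * (g₀ + a)) • u + (x₁ + r * (g₁ + b)) • v ∈ (K : Set Plane) := by
    intro a b ha hb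
    convert hin a b ha hb using 1
    conv_rhs => rw [hx, hg]
    module
  have c1 := coord _ _ (hin' (1 / 2) (1 / 2) (by norm_num) (by norm_num))
  have c2 := coord _ _ (hin' (-(1 / 2)) (-(1 / 2)) (by norm_num) (by norm_num))
  simp only [add_sub_add_left_eq_sub, ← sub_eq_add_neg] at c1 c2
  obtain ⟨hrR, hg₀⟩ := abs_le_of_nested c1.1 c2.1
  obtain ⟨-, hg₁⟩ := abs_le_of_nested c1.2 c2.2
  have hr1 : r ≤ 1 := by linarith
  obtain ⟨η, hη, hball⟩ := Metric.mem_nhds_iff.1 (mem_interior_iff_mem_nhds.1 h0)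
  obtain ⟨δ, hδ, hδK⟩ : ∃ δ : ℝ, 0 < δ ∧ ∀ a b : ℝ, |a| ≤ δ → |b| ≤ δ →
      a • u + b • v ∈ (K : Set Plane) := by
    refine ⟨η / (2 * (‖u‖ + ‖v‖ + 1)), by positivity, fun a b ha hb => hball ?_⟩
    rw [mem_ball_zero_iff]
    have hδ : 0 < η / (2 * (‖u‖ + ‖v‖ + 1)) := by positivity
    have hδ' : η / (2 * (‖u‖ + ‖v‖ + 1)) * (‖u‖ + ‖v‖ + 1) = η / 2 := by
      field_simp
    calc ‖a • u + b • v‖ ≤ ‖a • u‖ + ‖b • v‖ := norm_add_le _ _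
      _ = |a| * ‖u‖ + |b| * ‖v‖ := by rw [norm_smul, norm_smul, Real.norm_eq_abs, Real.norm_eq_abs]
      _ ≤ η / (2 * (‖u‖ + ‖v‖ + 1)) * ‖u‖ + η / (2 * (‖u‖ + ‖v‖ + 1)) * ‖v‖ := by gcongr
      _ < η := by linarith
  have d1 := coord _ _ (hδK δ δ (abs_of_pos hδ).le (abs_of_pos hδ).le)
  have d2 := coord _ _ (hδK (-δ) (-δ) (by rw [abs_neg, abs_of_pos hδ])
    (by rw [abs_neg, abs_of_pos hδ]))
  have hs : |x₀ + R * g₀| < R / 2 := by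
    have a := abs_le.1 d1.1
    have b := abs_le.1 d2.1
    exact abs_lt.2 ⟨by linarith [a.2], by linarith [b.1]⟩
  have ht : |x₁ + R * g₁| < R / 2 := by
    have a := abs_le.1 d1.2
    have b := abs_le.1 d2.2
    exact abs_lt.2 ⟨by linarith [a.2], by linarith [b.1]⟩
  have key := sq_mul_inv_add_inv_le huv K.isCompact.measure_lt_top.ne hDfin (q := x + r • g) hr
    (fun a b ha hb => by
      convert hin a b ha hb using 1
      module) hout' hs ht hvol'
  refine ⟨x₀ + R * g₀ - (R - 1) * g₀, x₁ + R * g₁ - (R - 1) * g₁, ?_, ?_, ?_⟩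
  · exact abs_sub_le_mul_sqrt hε hε1 hr1 hsum hR
      (sq_le_of_inv_add_inv_le hε hε1 hr hr1 hR hs ht key) hg₀
  · exact abs_sub_le_mul_sqrt hε hε1 hr1 hsum hR
      (sq_le_of_inv_add_inv_le hε hε1 hr hr1 hR ht hs (by rwa [mul_comm (_ + _)]))
      hg₁
  · conv_lhs => rw [hx, hg]
    module

theorem eq_of_isCentre {S : Set Plane} {c e u v : Plane} (huv : cross u v ≠ 0)
    (hS : ∀ z, z ∈ S ↔ ∃ a b : ℝ, |a| ≤ 1 / 2 ∧ |b| ≤ 1 / 2 ∧ z = e + (a • u + b • v))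
    (hc : IsCentre c S) : c = e := by
  have hce := exists_eq_smul_add_smul huv (c - e)
  set α := cross (c - e) v / cross u v
  set β := cross u (c - e) / cross u v
  have refl_mem : ∀ a b : ℝ, |a| ≤ 1 / 2 → |b| ≤ 1 / 2 →
      |2 * α - a| ≤ 1 / 2 ∧ |2 * β - b| ≤ 1 / 2 := by
    intro a b ha hb
    have h1 : c + ((e + (a • u + b • v)) - c) ∈ S := by
      rw [add_sub_cancel]
      exact (hS _).2 ⟨a, b, ha, hb, rfl⟩
    obtain ⟨a', b', ha', hb', he⟩ := (hS _).1 (hc.neg_add_mem h1)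
    have : (2 * α - a) • u + (2 * β - b) • v = a' • u + b' • v := by
      have e1 : (2 * α - a) • u + (2 * β - b) • v
          = (2 : ℝ) • (α • u + β • v) - (a • u + b • v) := by module
      rw [e1, ← hce, ← sub_eq_iff_eq_add'.2 he]
      module
    obtain ⟨h2, h3⟩ := coords_unique huv this
    rw [h2, h3]
    exact ⟨ha', hb'⟩
  have p := refl_mem (1 / 2) (1 / 2) (by norm_num) (by norm_num)
  have q := refl_mem (-(1 / 2)) (-(1 / 2)) (by norm_num) (by norm_num)
  simp only [abs_le] at p q
  have hα : α = 0 := by linarith [p.1.1, q.1.2]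
  have hβ : β = 0 := by linarith [p.2.1, q.2.2]
  rw [hα, hβ, zero_smul, zero_smul, add_zero] at hce
  exact sub_eq_zero.1 hce

/-- The edges are orthogonal of equal length and the diagonal is at most $1$, so $2B(u,u)\le1$ and
the squared norm is $(a^2+b^2)B(u,u)\le m^2$. -/
theorem normOf_le_of_coords {B : LinearMap.BilinForm ℝ Plane} (hB : IsInnerProduct B)
    {u v : Plane} (horth : B u v = 0) (heq : normOf B u = normOf B v) (hdiam : normOf B (u + v) ≤ 1)
    {a b m : ℝ} (ha : |a| ≤ m) (hb : |b| ≤ m) : normOf B (a • u + b • v) ≤ m := by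
  have nonneg : ∀ w, 0 ≤ B w w := fun w => by
    rcases eq_or_ne w 0 with rfl | hw
    · simp
    · exact (hB.2 w hw).le
  have horth' : B v u = 0 := by rw [hB.1, horth]
  have huv : B u u = B v v := by
    unfold normOf at heq
    exact (Real.sqrt_inj (nonneg u) (nonneg v)).1 heq
  have expand : ∀ s t : ℝ, B (s • u + t • v) (s • u + t • v) = (s ^ 2 + t ^ 2) * B u u := by
    intro s t
    simp only [map_add, map_smul, LinearMap.add_apply, LinearMap.smul_apply, smul_eq_mul, horth,
      horth', ← huv]
    ring
  have hd : 2 * B u u ≤ 1 := by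
    have h := expand 1 1
    rw [one_smul, one_smul] at h
    unfold normOf at hdiam
    rw [Real.sqrt_le_left zero_le_one] at hdiam
    linarith
  have hm : 0 ≤ m := (abs_nonneg a).trans ha
  unfold normOf
  rw [Real.sqrt_le_left hm, expand]
  have h1 : a ^ 2 ≤ m ^ 2 := sq_le_sq' (abs_le.1 ha).1 (abs_le.1 ha).2
  have h2 : b ^ 2 ≤ m ^ 2 := sq_le_sq' (abs_le.1 hb).1 (abs_le.1 hb).2
  nlinarith [nonneg u, sq_nonneg m]

theorem normOf_centre_le (K : ConvexBody Plane) (h0 : (0 : Plane) ∈ interior (K : Set Plane))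
    {ε : ℝ} (hε : 0 < ε) (hε1 : 200 * ε < 1)
    (hvol : volume (K : Set Plane) * volume (polarSet (K : Set Plane)) ≤
      ENNReal.ofReal ((1 + ε) * 8))
    {P : Set Plane} {x : Plane} {l₁ l₂ : ℝ} (hl₁ : 0 < l₁) (hl₂ : 0 < l₂)
    (hin : x +ᵥ l₁ • P ⊆ (K : Set Plane)) (hout : (K : Set Plane) ⊆ x +ᵥ l₂ • P)
    (hratio : l₂ / l₁ ≤ 1 + 200 * ε) {B : LinearMap.BilinForm ℝ Plane} (hB : IsInnerProduct B)
    (hsq : IsSquareFor B (((l₁ + l₂) / 2) • P)) (hdiam : HasDiameterFor B (((l₁ + l₂) / 2) • P) 1)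
    {c : Plane} (hc : IsCentre c (x +ᵥ ((l₁ + l₂) / 2) • P)) : normOf B c ≤ 17 * √ε := by
  obtain ⟨q, w, hw, horth, heq, hM⟩ := hsq
  set l := (l₁ + l₂) / 2 with hl
  have hl0 : 0 < l := by positivity
  have hcross := cross_ne_zero_of_linearIndependent hw
  set g := q + (1 / 2 : ℝ) • (w 0 + w 1)
  set M := l • P with hMdef
  have memM : ∀ z, z ∈ M ↔ ∃ a b : ℝ, |a| ≤ 1 / 2 ∧ |b| ≤ 1 / 2 ∧
      z = g + (a • w 0 + b • w 1) := fun z => by rw [hM, mem_vadd_parallelepiped]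
  have scale : ∀ s : ℝ, s • P = (s / l) • M := fun s => by
    rw [hMdef, smul_smul, div_mul_cancel₀ _ hl0.ne']
  have hin' : ∀ a b : ℝ, |a| ≤ 1 / 2 → |b| ≤ 1 / 2 →
      x + (l₁ / l) • (g + (a • w 0 + b • w 1)) ∈ (K : Set Plane) := by
    intro a b ha hb
    apply hin
    rw [scale]
    exact vadd_mem_vadd_set (smul_mem_smul_set ((memM _).2 ⟨a, b, ha, hb, rfl⟩))
  have hout' : ∀ z ∈ (K : Set Plane), ∃ a b : ℝ, |a| ≤ 1 / 2 ∧ |b| ≤ 1 / 2 ∧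
      z = x + (l₂ / l) • (g + (a • w 0 + b • w 1)) := by
    intro z hz
    have := hout hz
    rw [scale] at this
    obtain ⟨_, ⟨m, hm, rfl⟩, rfl⟩ := this
    obtain ⟨a, b, ha, hb, rfl⟩ := (memM _).1 hm
    exact ⟨a, b, ha, hb, rfl⟩
  have hcentre : c = x + g := by
    refine eq_of_isCentre hcross (fun z => ?_) hc
    rw [mem_vadd_set_iff_neg_vadd_mem, memM, vadd_eq_add]
    refine exists_congr fun a => exists_congr fun b => and_congr_right fun _ =>
      and_congr_right fun _ => ?_
    rw [neg_add_eq_iff_eq_add, add_assoc x]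
  -- The sum $w_0+w_1$ joins opposite corners of $M$.
  have hd : normOf B (w 0 + w 1) ≤ 1 := by
    refine hdiam.1 ⟨g + ((1 / 2 : ℝ) • w 0 + (1 / 2 : ℝ) • w 1), (memM _).2 ⟨_, _, ?_, ?_, rfl⟩,
      g + ((-1 / 2 : ℝ) • w 0 + (-1 / 2 : ℝ) • w 1), (memM _).2 ⟨_, _, ?_, ?_, rfl⟩, ?_⟩
    any_goals norm_num [abs_le]
    congr 1
    module
  have hr : 0 < l₁ / l := by positivity
  have hR0 : 0 < l₂ / l := by positivity
  have hsum : l₁ / l + l₂ / l = 2 := by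
    rw [← add_div, div_eq_iff hl0.ne', hl]; ring
  have hR : l₂ / l ≤ (1 + 200 * ε) * (l₁ / l) := by
    rw [div_le_iff₀ hl₁] at hratio
    rw [← mul_div_assoc]
    gcongr
  rw [hcentre]
  -- A negatively oriented pair of edges is exchanged.
  rcases hcross.lt_or_gt with hneg | hpos
  · obtain ⟨a, b, ha, hb, hab⟩ := exists_centre_coords K h0 hε hε1 hvol (x := x) (g := g)
      (u := w 1) (v := w 0) (by rw [cross_swap]; linarith) hr hR0 hsum hR
      (fun a b ha hb => by
        rw [add_comm (a • w 1)]
        exact hin' b a hb ha)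
      (fun z hz => by
        obtain ⟨a, b, ha, hb, rfl⟩ := hout' z hz
        exact ⟨b, a, hb, ha, by rw [add_comm (b • w 1)]⟩)
    rw [hab, add_comm]
    exact normOf_le_of_coords hB horth heq hd hb ha
  · obtain ⟨a, b, ha, hb, hab⟩ :=
      exists_centre_coords K h0 hε hε1 hvol hpos hr hR0 hsum hR hin' hout'
    rw [hab]
    exact normOf_le_of_coords hB horth heq hd ha hb

end PlanarBody

theorem theorem1 (K : ConvexBody PlanarBody.Plane)
    (hsymm : ∃ k, PlanarBody.IsCentre k (K : Set PlanarBody.Plane))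
    (h0 : (0 : PlanarBody.Plane) ∈ interior (K : Set PlanarBody.Plane))
    (ε : ℝ) (hε : 0 < ε)
    (hvol : volume (K : Set PlanarBody.Plane) *
        volume (PlanarBody.polarSet (K : Set PlanarBody.Plane)) ≤
      ENNReal.ofReal ((1 + ε) * 8)) :
    (∀ P : Set PlanarBody.Plane, PlanarBody.IsParallelogram P →
      PlanarBody.banachMazurDist (K : Set PlanarBody.Plane) P ≤ 1 + 200 * ε) ∧
    (∀ (P : Set PlanarBody.Plane) (x : PlanarBody.Plane) (l₁ l₂ : ℝ),
      PlanarBody.IsParallelogram P → 0 < l₁ → 0 < l₂ →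
      x +ᵥ l₁ • P ⊆ (K : Set PlanarBody.Plane) →
      (K : Set PlanarBody.Plane) ⊆ x +ᵥ l₂ • P →
      l₂ / l₁ ≤ 1 + 200 * ε → 1 + 200 * ε < 2 →
      ∀ B : LinearMap.BilinForm ℝ PlanarBody.Plane, PlanarBody.IsInnerProduct B →
        PlanarBody.IsSquareFor B (((l₁ + l₂) / 2) • P) →
        PlanarBody.HasDiameterFor B (((l₁ + l₂) / 2) • P) 1 →
        ∀ c : PlanarBody.Plane, PlanarBody.IsCentre c (x +ᵥ ((l₁ + l₂) / 2) • P) →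
          PlanarBody.normOf B c ≤ 336 * √ε) := by
  obtain ⟨k, hk⟩ := hsymm
  refine ⟨fun P hP => ?_, fun P x l₁ l₂ _ hl₁ hl₂ hin hout hratio hε1 B hB hsq hdiam c hc => ?_⟩
  · obtain ⟨u, v, huv, h₁, h₂⟩ := PlanarBody.exists_parallelogram_between K hk h0 hε hvol
    exact PlanarBody.banachMazurDist_le_of_between (by positivity) huv h₁ h₂ hP
  -- The argument gives the smaller constant $17$.
  · refine (PlanarBody.normOf_centre_le K h0 hε (by linarith) hvol hl₁ hl₂ hin hout hratio hB hsq
      hdiam hc).trans ?_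
    gcongr
    norm_num
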